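/- **Model.** Time is continuous. There are $n\ge 2$ identical agents and a public good with stock $x_t\ge 0$. At each time $t\ge 0$ agent $i$ exerts effort $a^i_t\in[0,1]$ and receives the flow payoff $u(a^i_t,x_t)=b(x_t)-c(a^i_t,x_t)$, where $b(x):=u(0,x)$ and $c(a,x):=u(0,x)-u(a,x)$; the discount rate is normalised to $1$. Agent $i$ produces increments of the stock at rate $\lambda a^i_t$, where $\lambda>0$; the sizes of increments are drawn from a distribution $F$ with $F(0)=0$ and finite mean $\mu$, and the production and the sizes of increments are independent across agents, time, and from each other. A *history* is a finite sequence $h=(x_0,(t_1,z_1,i_1),\dots,(t_m,z_m,i_m))$ recording the initial stock and the times, sizes and producers of past increments. A *strategy* assigns to each history $h$ (jointly measurably in history and time) an effort schedule with values in $[0,1]$, followed from time $t_m$ (with $t_0:=0$) until the next increment. A strategy is *Markov* if it is given by a Borel map $\alpha:[0,\infty)\to[0,1]$ such that effort at any time is $\alpha(x_t)$. Given a strategy profile $\sigma=(\sigma^i)_{i=1}^n$ and an initial stock $x_0\ge 0$, the payoff of agent $i$ is $v^i_\sigma(x_0)=\mathbb E\int_0^\infty e^{-t}\,[b(\tilde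 x_t)-c(\tilde a^i_t,\tilde x_t)]\,dt$, welfare is $\frac1n\sum_{i=1}^n v^i_\sigma(x_0)$, and maximal welfare $v_*(x_0)$ is the supremum of welfare over all strategy profiles, Markov or not. **Assumptions** ("increasing", "decreasing", "convex" and "concave" are weak). $u:[0,1]\times[0,\infty)\to\mathbb R$ is twice continuously differentiable, and increasing and concave in $x$; $c(a,x)$ is increasing and convex in $a$, and strictly increasing in $a$ if $x>0$; the partial derivatives $c_1(a,x)=\partial c/\partial a$ and $c_{11}(a,x)=\partial^2c/\partial a^2$ are increasing in $x$; and, for all $0<a\le 1$, the limit $\lim_{x\to\infty}\bigl(\lambda\mu n\,b'(x)-c_1(a,x)\bigr)\in[-\infty,\infty)$ is strictly negative. **Proposition.** All payoffs are well defined (the discounted flow payoff is integrable for every strategy profile), and the following hold. 1. There is a Markov strategy $\alpha_*$ that, if played by all agents, maximises welfare among all strategy profiles (Markov or not, symmetric or not) for every initial stock $x_0\ge 0$; in particular it attains $v_*(x_0)$. For each $x\ge 0$, $\alpha_*(x)$ is the smallest element of $$\arg\max_{a\in[0,1]}\bigl\{a\lambda n\,\{\mathbb E_F[v_*(x+\tilde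 z)]-v_*(x)\}-c(a,x)\bigr\}.$$ 2. $\alpha_*(x)$ is decreasing in $x\ge 0$ and, for every initial stock $x_0\ge 0$, when all agents play $\alpha_*$, $\alpha_*(\tilde x_t)\to 0$ almost surely as $t\to\infty$. 3. $v_*$ is increasing on $[0,\infty)$, and $v_*-b$ is decreasing on $[0,\infty)$ and $v_*(x)-b(x)\to 0$ as $x\to\infty$. -/

import Mathlib

open Set Filter Topology MeasureTheory ProbabilityTheory

noncomputable section

namespace CollectiveInnovation

/-! ### Primitives of the game -/

/-- The primitives of the game: `n ≥ 2` identical agents; the rate `lam > 0` at which an agent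
exerting effort `a` produces increments is `lam * a`; increments have law `F`, which charges only
strictly positive sizes and has a finite mean; `u a x` is the flow payoff to an agent exerting
effort `a ∈ [0,1]` when the stock is `x ≥ 0` (other values of `u` are irrelevant). The discount
rate is normalised to `1`. -/
structure Game (n : ℕ) where
  two_le : 2 ≤ n
  lam : ℝ
  lam_pos : 0 < lam
  F : Measure ℝ
  F_prob : IsProbabilityMeasure F
  F_pos : F (Iic 0) = 0
  F_mean : Integrable (fun z : ℝ => z) F
  u : ℝ → ℝ → ℝ

attribute [instance] Game.F_prob

namespace Game

variable {n : ℕ} (G : Game n)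

/-- Mean size of an increment. -/
def mu : ℝ := ∫ z, z ∂G.F

/-- Gross benefits `b(x) = u(0,x)`. -/
def b (x : ℝ) : ℝ := G.u 0 x

/-- Opportunity cost of effort `c(a,x) = u(0,x) - u(a,x)`. -/
def c (a x : ℝ) : ℝ := G.u 0 x - G.u a x

/-- `b'(x)`, one-sided at `x = 0`. -/
def bDeriv (x : ℝ) : ℝ := derivWithin G.b (Ici 0) x

/-- `c₁(a,x)`, one-sided at `a = 0` and `a = 1`. -/
def c1 (a x : ℝ) : ℝ := derivWithin (fun a' => G.c a' x) (Icc 0 1) a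

/-- `c₁₁(a,x)`, one-sided at `a = 0` and `a = 1`. -/
def c11 (a x : ℝ) : ℝ := derivWithin (fun a' => G.c1 a' x) (Icc 0 1) a

/-- The standing assumptions on payoffs. Monotonicity and concavity are in the weak sense. The
limit in `limit_neg` is allowed to be `-∞`. -/
structure StandingAssumptions : Prop where
  smooth : ContDiffOn ℝ 2 (fun p : ℝ × ℝ => G.u p.1 p.2) (Icc 0 1 ×ˢ Ici 0)
  u_mono : ∀ a ∈ Icc (0 : ℝ) 1, MonotoneOn (fun x => G.u a x) (Ici 0)
  u_concave : ∀ a ∈ Icc (0 : ℝ) 1, ConcaveOn ℝ (Ici 0) (fun x => G.u a x)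
  c_mono : ∀ x, 0 ≤ x → MonotoneOn (fun a => G.c a x) (Icc 0 1)
  c_convex : ∀ x, 0 ≤ x → ConvexOn ℝ (Icc 0 1) (fun a => G.c a x)
  c_strictMono : ∀ x, 0 < x → StrictMonoOn (fun a => G.c a x) (Icc 0 1)
  c1_mono : ∀ a ∈ Icc (0 : ℝ) 1, MonotoneOn (fun x => G.c1 a x) (Ici 0)
  c11_mono : ∀ a ∈ Icc (0 : ℝ) 1, MonotoneOn (fun x => G.c11 a x) (Ici 0)
  limit_neg : ∀ a ∈ Ioc (0 : ℝ) 1, ∃ l : EReal, l < 0 ∧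
    Tendsto (fun x : ℝ => ((G.lam * G.mu * n * G.bDeriv x - G.c1 a x : ℝ) : EReal)) atTop (𝓝 l)

end Game

/-! ### Histories and strategies -/

/-- An innovation `(t, z, i)`: agent `i` produces an increment of size `z` at time `t`. -/
abbrev Innovation (n : ℕ) : Type := ℝ × ℝ × Fin n

/-- A history `(x₀, (t₁,z₁,i₁), …, (t_m,z_m,i_m))` featuring `m` innovations. The constraints
`0 ≤ x₀`, `0 < t₁ < ⋯ < t_m` and `0 < z_l` are not imposed on the type; from an initial stock
`x₀ ≥ 0` they hold almost surely for every history reached in the game, so what a strategy does at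
other sequences has no effect. -/
abbrev History (n m : ℕ) : Type := ℝ × (Fin m → Innovation n)

namespace History

variable {n m : ℕ}

/-- The current stock `X(h) = x₀ + ∑ z_l`. -/
def stock (h : History n m) : ℝ := h.1 + ∑ l, (h.2 l).2.1

/-- The history `h ⌢ (t, z, i)`. -/
def append (h : History n m) (e : Innovation n) : History n (m + 1) :=
  (h.1, Fin.snoc (α := fun _ => Innovation n) h.2 e)

theorem measurable_stock : Measurable (stock : History n m → ℝ) := by
  unfold stock
  fun_prop

end History

/-- A (pure) strategy: after each history `h` it prescribes a measurable effort schedule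
`t ↦ effort h t ∈ [0,1]`, followed from the time of the last innovation of `h` until the next
innovation. It is jointly measurable in the history and time. -/
structure Strategy (n : ℕ) where
  effort : ∀ m : ℕ, History n m → ℝ → ℝ
  measurable : ∀ m : ℕ, Measurable (fun p : History n m × ℝ => effort m p.1 p.2)
  mem_Icc : ∀ (m : ℕ) (h : History n m) (t : ℝ), effort m h t ∈ Icc (0 : ℝ) 1

/-- A Markov strategy: a Borel map from stocks to efforts. Only its values on `[0,∞)` matter. -/
structure MarkovStrategy where
  effort : ℝ → ℝ
  measurable : Measurable effort
  mem_Icc : ∀ x, effort x ∈ Icc (0 : ℝ) 1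

/-- The strategy that exerts effort `α(X(h))` at every history `h` and at every later time. -/
def MarkovStrategy.toStrategy (n : ℕ) (α : MarkovStrategy) : Strategy n where
  effort _ h _ := α.effort h.stock
  measurable _ := α.measurable.comp (History.measurable_stock.comp measurable_fst)
  mem_Icc _ h _ := α.mem_Icc h.stock

/-! ### The random path of play

Agents have independent Poisson clocks of rate `lam`, that is, opportunities arrive at the times of
a Poisson process of rate `n * lam` and each one belongs to a uniformly drawn agent. An
opportunity of agent `i` at time `t` carries an independent uniform mark in `[0,1]` and an
independent size `z ∼ F`; it becomes an innovation of size `z` if and only if the mark does not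
exceed the effort that `i` exerts at `t`. Hence, whatever the past, agent `i` produces innovations
at rate `lam * aᵢ(t)`, with independent sizes distributed according to `F`: given a history `h`,
the next innovation occurs in `dt` and is due to agent `i` with density
`lam * aᵢ(t) * exp (-lam * ∫_{T(h)}^t ∑ⱼ aⱼ)`. -/

/-- An opportunity: waiting time since the previous one, agent, mark, and size. -/
abbrev Opportunity (n : ℕ) : Type := ℝ × Fin n × unitInterval × ℝ

/-- The sample space: sequences of opportunities. -/
abbrev Sample (n : ℕ) : Type := ℕ → Opportunity n

/-- Time of arrival of the first `k` opportunities (`0` if `k = 0`). -/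
def arrival {n : ℕ} (ω : Sample n) (k : ℕ) : ℝ := ∑ j ∈ Finset.range k, (ω j).1

/-- Number of opportunities arrived by time `t` (almost surely finite). -/
def count {n : ℕ} (ω : Sample n) (t : ℝ) : ℕ := sSup {k : ℕ | arrival ω k ≤ t}

/-- The history reached after the first `k` opportunities, when the profile `σ` is played from the
initial stock `x₀`. -/
def reached {n : ℕ} (σ : Fin n → Strategy n) (x₀ : ℝ) (ω : Sample n) : ℕ → Σ m, History n m
  | 0 => ⟨0, (x₀, Fin.elim0)⟩
  | k + 1 =>
    let h := reached σ x₀ ω k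
    let t := arrival ω (k + 1)
    let i := (ω k).2.1
    if ((ω k).2.2.1 : ℝ) ≤ (σ i).effort h.1 h.2 t then
      ⟨h.1 + 1, h.2.append (t, (ω k).2.2.2, i)⟩
    else h

/-- The history reached by time `t`. -/
def historyAt {n : ℕ} (σ : Fin n → Strategy n) (x₀ : ℝ) (ω : Sample n) (t : ℝ) :
    Σ m, History n m :=
  reached σ x₀ ω (count ω t)

/-- The stock `x_t`. -/
def stockAt {n : ℕ} (σ : Fin n → Strategy n) (x₀ : ℝ) (ω : Sample n) (t : ℝ) : ℝ :=
  (historyAt σ x₀ ω t).2.stock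

/-- The effort `a^i_t` of agent `i`. -/
def effortAt {n : ℕ} (σ : Fin n → Strategy n) (i : Fin n) (x₀ : ℝ) (ω : Sample n) (t : ℝ) : ℝ :=
  (σ i).effort _ (historyAt σ x₀ ω t).2 t

namespace Game

variable {n : ℕ} (G : Game n)

/-- Law of one opportunity. -/
def opportunityLaw : Measure (Opportunity n) :=
  (expMeasure (n * G.lam)).prod
    ((uniformOn (univ : Set (Fin n))).prod ((volume : Measure unitInterval).prod G.F))

instance instIsProbabilityMeasureOpportunityLaw : IsProbabilityMeasure G.opportunityLaw := by
  have hn : 0 < n := lt_of_lt_of_le (by norm_num) G.two_le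
  have : Nonempty (Fin n) := ⟨⟨0, hn⟩⟩
  have : IsProbabilityMeasure (expMeasure (n * G.lam)) :=
    isProbabilityMeasure_expMeasure (mul_pos (Nat.cast_pos.mpr hn) G.lam_pos)
  unfold opportunityLaw
  infer_instance

/-- The law of the sequence of opportunities: they are independent and identically distributed. -/
def P : Measure (Sample n) := Measure.infinitePi (fun _ : ℕ => G.opportunityLaw)

/-! ### Payoffs and welfare -/

/-- The discounted flow payoff `e^{-t} [b(x_t) - c(a^i_t, x_t)]` of agent `i`. -/
def discountedFlow (σ : Fin n → Strategy n) (i : Fin n) (x₀ : ℝ) (ω : Sample n) (t : ℝ) : ℝ :=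
  Real.exp (-t) * (G.b (stockAt σ x₀ ω t) - G.c (effortAt σ i x₀ ω t) (stockAt σ x₀ ω t))

/-- The ex-ante payoff of agent `i` from the profile `σ`, given the initial stock `x₀`. -/
def payoff (σ : Fin n → Strategy n) (i : Fin n) (x₀ : ℝ) : ℝ :=
  ∫ ω, (∫ t in Ioi (0 : ℝ), G.discountedFlow σ i x₀ ω t) ∂G.P

/-- Welfare: the average of the ex-ante payoffs across agents. -/
def welfare (σ : Fin n → Strategy n) (x₀ : ℝ) : ℝ := (1 / (n : ℝ)) * ∑ i, G.payoff σ i x₀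

/-- Maximal welfare `v_*(x₀)` across all strategy profiles, Markov or not. -/
def maxWelfare (x₀ : ℝ) : ℝ := sSup (range fun σ : Fin n → Strategy n => G.welfare σ x₀)

/-- The maximisers over `a ∈ [0,1]` of the net social value of effort,
`a λ n {E_F[v_*(x + z)] - v_*(x)} - c(a,x)`. -/
def efficientEfforts (x : ℝ) : Set ℝ :=
  {a | a ∈ Icc (0 : ℝ) 1 ∧
    IsMaxOn (fun a => a * G.lam * n * ((∫ z, G.maxWelfare (x + z) ∂G.F) - G.maxWelfare x) - G.c a x)
      (Icc 0 1) a}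

end Game

end CollectiveInnovation

end

/-!
Since every flow payoff is a function of the current history and time, it suffices to look at play
at the opportunities: writing `r = n * lam` for their arrival rate, `T k` for the arrival time of
the `k`-th one, `x k` for the stock after it and `a k` for an agent's effort when the next one
arrives, the payoff of the agent is `r⁻¹ ∑ E[exp (-T (k + 1)) * u (a k) (x k)]`
(`payoff_eq`, which rests on `lintegral_until_arrival`). The problem becomes a discrete dynamic programme with Bellman
equation `(1 + r) v(x) = max_a {u(a,x) + r (a E v(x + z) + (1 - a) v(x))}`.

*Solving the Bellman equation.* The iterates of the Bellman operator started at `b` increase to a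
solution `v` (`exists_isSolution`). The operator preserves the properties that `v` is increasing,
that `v - b` is decreasing, and that `b ≤ v ≤ b + r μ b'(0)`, so the solution has them.

*Verification.* Along any path of play, accumulated welfare plus the discounted value of `v` is a
supermartingale (`sum_stageValue_le`): the Bellman inequality holds at the effort of each agent, so
averaging over agents is enough and no symmetry of the profile is needed. It is a martingale if all
agents exert the smallest maximising effort (`sum_stageValue_eq`), and the discounted value vanishes
in the limit (`tendsto_lintegral_discount`). Hence `v` is maximal welfare. After subtracting the
minimal flow payoff `u(1,0)`, all quantities are nonnegative and these computations take place in
`[0,∞]`; integrability of the flow payoffs is a by-product of the upper bound.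

*Monotonicity of effort.* Let `P(x) = r (E v(x + z) - v(x))` and `w = v - b`, so that
`w(x) = max_a {a P(x) - c(a,x)}`. It is not `P` but `P / r + w = E v(x + z) - b(x)` that is seen
directly to be decreasing. At an interior maximiser `a` this quantity equals
`c₁(a,x) / r + (a c₁(a,x) - c(a,x))`, which increases with `x` because `c₁` and `c₁₁` do; it
follows that the smallest maximiser decreases (`optimalEffort_antitoneOn`).

*Limits.* As `w` is decreasing, `P(x) ≤ r μ b'(x)`, which is eventually less than `c₁(a,x)` for each
`a > 0`. Hence the optimal effort `α(x)` vanishes at large stocks, and so does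
`w(x) ≤ P(x) α(x)`. If effort did not vanish along a path of play, then by the second Borel–Cantelli
lemma the stock would diverge, a contradiction (`ae_tendsto_effort`).
-/

/-! ### Regularity and monotonicity of the primitives -/

namespace CollectiveInnovation

lemma monotoneOn_Icc_of_hasDerivWithinAt {f f' : ℝ → ℝ}
    (hf : ∀ a ∈ Icc (0 : ℝ) 1, HasDerivWithinAt f (f' a) (Icc 0 1) a)
    (hf' : ∀ a ∈ Icc (0 : ℝ) 1, 0 ≤ f' a) : MonotoneOn f (Icc 0 1) :=
  monotoneOn_of_hasDerivWithinAt_nonneg (convex_Icc 0 1)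
    (fun a ha => (hf a ha).continuousWithinAt)
    (fun a ha => (hf a (interior_subset ha)).mono interior_subset)
    (fun a ha => hf' a (interior_subset ha))

namespace Game

variable {n : ℕ} (G : Game n)

/-- The arrival rate `n * lam` of opportunities; total effort `n * a` produces increments at rate
`G.rate * a`. -/
noncomputable def rate : ℝ := n * G.lam

lemma rate_pos : 0 < G.rate :=
  mul_pos (Nat.cast_pos.mpr (lt_of_lt_of_le (by norm_num) G.two_le)) G.lam_pos

lemma c_zero (x : ℝ) : G.c 0 x = 0 := by simp [c]

lemma u_eq (a x : ℝ) : G.u a x = G.b x - G.c a x := by simp [b, c]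

lemma ae_pos : ∀ᵐ z ∂G.F, 0 < z := by
  rw [ae_iff]
  simpa [Iic] using G.F_pos

lemma mu_nonneg : 0 ≤ G.mu :=
  integral_nonneg_of_ae (G.ae_pos.mono fun _ hz => hz.le)

namespace StandingAssumptions

variable {G} (hG : G.StandingAssumptions)
include hG

lemma contDiffOn_c {x : ℝ} (hx : 0 ≤ x) : ContDiffOn ℝ 2 (fun a => G.c a x) (Icc 0 1) := by
  have h1 : ContDiffOn ℝ 2 (fun a : ℝ => G.u a x) (Icc 0 1) :=
    hG.smooth.comp (f := fun a : ℝ => (a, x)) (by fun_prop) (fun a ha => ⟨ha, hx⟩)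
  exact contDiffOn_const.sub h1

lemma contDiffOn_b : ContDiffOn ℝ 2 G.b (Ici 0) :=
  hG.smooth.comp (f := fun x : ℝ => ((0 : ℝ), x)) (by fun_prop)
    (fun x hx => ⟨⟨le_rfl, zero_le_one⟩, hx⟩)

lemma hasDerivWithinAt_c {a x : ℝ} (ha : a ∈ Icc (0 : ℝ) 1) (hx : 0 ≤ x) :
    HasDerivWithinAt (fun a => G.c a x) (G.c1 a x) (Icc 0 1) a :=
  ((hG.contDiffOn_c hx).differentiableOn (by norm_num) a ha).hasDerivWithinAt

lemma hasDerivWithinAt_c1 {a x : ℝ} (ha : a ∈ Icc (0 : ℝ) 1) (hx : 0 ≤ x) :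
    HasDerivWithinAt (fun a => G.c1 a x) (G.c11 a x) (Icc 0 1) a := by
  have h := (hG.contDiffOn_c hx).derivWithin (m := 1) (uniqueDiffOn_Icc zero_lt_one) (by norm_num)
  exact (h.differentiableOn (by norm_num) a ha).hasDerivWithinAt

lemma hasDerivWithinAt_b {x : ℝ} (hx : 0 ≤ x) :
    HasDerivWithinAt G.b (G.bDeriv x) (Ici 0) x :=
  (hG.contDiffOn_b.differentiableOn (by norm_num) x hx).hasDerivWithinAt

lemma continuousOn_c {x : ℝ} (hx : 0 ≤ x) : ContinuousOn (fun a => G.c a x) (Icc 0 1) :=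
  (hG.contDiffOn_c hx).continuousOn

lemma b_mono : MonotoneOn G.b (Ici 0) := hG.u_mono 0 ⟨le_rfl, zero_le_one⟩

lemma b_concave : ConcaveOn ℝ (Ici 0) G.b := hG.u_concave 0 ⟨le_rfl, zero_le_one⟩

lemma c_nonneg {a x : ℝ} (ha : a ∈ Icc (0 : ℝ) 1) (hx : 0 ≤ x) : 0 ≤ G.c a x := by
  have := hG.c_mono x hx (left_mem_Icc.2 zero_le_one) ha ha.1
  simpa [c_zero] using this

lemma c_le_c {a x y : ℝ} (ha : a ∈ Icc (0 : ℝ) 1) (hx : 0 ≤ x) (hxy : x ≤ y) :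
    G.c a x ≤ G.c a y := by
  have hy := hx.trans hxy
  have := monotoneOn_Icc_of_hasDerivWithinAt
    (f := fun a => G.c a y - G.c a x) (f' := fun a => G.c1 a y - G.c1 a x)
    (fun s hs => (hG.hasDerivWithinAt_c hs hy).sub (hG.hasDerivWithinAt_c hs hx))
    (fun s hs => sub_nonneg.2 (hG.c1_mono s hs hx hy hxy))
    (left_mem_Icc.2 zero_le_one) ha ha.1
  simp only [c_zero, sub_self] at this
  linarith

/-- The rent `a c₁(a,x) - c(a,x)` is the integral of `s c₁₁(s,x)` over `s ∈ [0,a]`, so it inherits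
from `c₁₁` its monotonicity in the stock. -/
lemma rent_le_rent {a x y : ℝ} (ha : a ∈ Icc (0 : ℝ) 1) (hx : 0 ≤ x) (hxy : x ≤ y) :
    a * G.c1 a x - G.c a x ≤ a * G.c1 a y - G.c a y := by
  have hy := hx.trans hxy
  have hd : ∀ w, 0 ≤ w → ∀ s ∈ Icc (0 : ℝ) 1,
      HasDerivWithinAt (fun s => s * G.c1 s w - G.c s w) (s * G.c11 s w) (Icc 0 1) s := by
    intro w hw s hs
    have := ((hasDerivWithinAt_id s (Icc 0 1)).mul (hG.hasDerivWithinAt_c1 hs hw)).sub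
      (hG.hasDerivWithinAt_c hs hw)
    exact this.congr_deriv (by simp)
  have := monotoneOn_Icc_of_hasDerivWithinAt
    (fun s hs => (hd y hy s hs).sub (hd x hx s hs))
    (fun s hs => by
      have := mul_le_mul_of_nonneg_left (hG.c11_mono s hs hx hy hxy) hs.1
      linarith)
    (left_mem_Icc.2 zero_le_one) ha ha.1
  simp only [Pi.sub_apply, c_zero] at this
  linarith

lemma c_ge_tangent {a s x : ℝ} (ha : a ∈ Icc (0 : ℝ) 1) (hs : s ∈ Icc (0 : ℝ) 1) (has : a ≤ s)
    (hx : 0 ≤ x) : G.c a x + G.c1 a x * (s - a) ≤ G.c s x := by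
  rcases has.eq_or_lt with rfl | h
  · simp
  have := (hG.c_convex x hx).le_slope_of_hasDerivWithinAt ha hs h (hG.hasDerivWithinAt_c ha hx)
  rw [slope_def_field, le_div_iff₀ (sub_pos.2 h)] at this
  linarith

/-- First-order condition at a maximiser `a < 1` of `a p - c(a,x)`. -/
lemma le_c1_of_isMaxOn {a x p : ℝ} (ha : a ∈ Icc (0 : ℝ) 1) (ha1 : a < 1) (hx : 0 ≤ x)
    (h : IsMaxOn (fun a => a * p - G.c a x) (Icc 0 1) a) : p ≤ G.c1 a x := by
  have hd : HasDerivWithinAt (fun a => G.c a x) (G.c1 a x) (Ioo a 1) a :=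
    (hG.hasDerivWithinAt_c ha hx).mono fun s hs => ⟨ha.1.trans hs.1.le, hs.2.le⟩
  rw [hasDerivWithinAt_iff_tendsto_slope' (by simp)] at hd
  have : (𝓝[Ioo a 1] a).NeBot := by
    rw [nhdsWithin_Ioo_eq_nhdsGT ha1]; infer_instance
  refine ge_of_tendsto hd (eventually_mem_nhdsWithin.mono fun s hs => ?_)
  have hm := isMaxOn_iff.1 h s ⟨ha.1.trans hs.1.le, hs.2.le⟩
  rw [slope_def_field, le_div_iff₀ (sub_pos.2 hs.1)]
  linarith

lemma b_add_sub_le {x z : ℝ} (hx : 0 ≤ x) (hz : 0 < z) :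
    G.b (x + z) - G.b x ≤ G.bDeriv x * z := by
  have := hG.b_concave.slope_le_of_hasDerivWithinAt (x := x) (y := x + z) hx
    (by simp only [mem_Ici]; linarith) (by linarith) (hG.hasDerivWithinAt_b hx)
  rw [slope_def_field, div_le_iff₀ (by linarith)] at this
  linarith

lemma b_increment_antitone {x y z : ℝ} (hx : 0 ≤ x) (hxy : x ≤ y) (hz : 0 < z) :
    G.b (y + z) - G.b y ≤ G.b (x + z) - G.b x := by
  rcases hxy.eq_or_lt with rfl | hlt
  · exact le_rfl
  have key := hG.b_concave.2
  -- `x + z` and `y` are convex combinations of `x` and `y + z` with exchanged weights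
  have hpos : 0 < y - x + z := by linarith
  have hxm : x ∈ Ici (0 : ℝ) := hx
  have hym : y + z ∈ Ici (0 : ℝ) := by simp only [mem_Ici]; linarith
  have e1 := key hxm hym (a := (y - x) / (y - x + z)) (b := z / (y - x + z))
    (div_nonneg (by linarith) hpos.le) (div_nonneg hz.le hpos.le) (by field_simp)
  have e2 := key hxm hym (a := z / (y - x + z)) (b := (y - x) / (y - x + z))
    (div_nonneg hz.le hpos.le) (div_nonneg (by linarith) hpos.le) (by field_simp; ring)
  have h1 : ((y - x) / (y - x + z)) • x + (z / (y - x + z)) • (y + z) = x + z := by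
    simp only [smul_eq_mul]; field_simp; ring
  have h2 : (z / (y - x + z)) • x + ((y - x) / (y - x + z)) • (y + z) = y := by
    simp only [smul_eq_mul]; field_simp; ring
  rw [h1] at e1
  rw [h2] at e2
  have h3 : (y - x) / (y - x + z) + z / (y - x + z) = 1 := by field_simp
  simp only [smul_eq_mul] at e1 e2
  have h4 : (y - x) / (y - x + z) = 1 - z / (y - x + z) := by linarith
  rw [h4] at e1 e2
  linarith

lemma bDeriv_nonneg {x : ℝ} (hx : 0 ≤ x) : 0 ≤ G.bDeriv x := by
  have h1 := hG.b_add_sub_le hx one_pos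
  have h2 := hG.b_mono hx (show x + 1 ∈ Ici (0 : ℝ) by simp only [mem_Ici]; linarith) (by linarith)
  linarith

end StandingAssumptions
end Game
end CollectiveInnovation

/-! ### The Bellman equation -/

namespace CollectiveInnovation
namespace Game

variable {n : ℕ} (G : Game n)

/-- The right-hand side of the uniformised Bellman equation
`(1 + r) v(x) = max_a {u(a,x) + r (a E v(x + z) + (1 - a) v(x))}`, where `r = G.rate`. -/
noncomputable def bellmanBody (v : ℝ → ℝ) (a x : ℝ) : ℝ :=
  G.u a x + G.rate * (a * (∫ z, v (x + z) ∂G.F) + (1 - a) * v x)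

/-- The Bellman operator. Negative stocks are treated as the stock `0`, so that functions in its
range are monotone on all of `ℝ`. -/
noncomputable def bellman (v : ℝ → ℝ) (x : ℝ) : ℝ :=
  (1 + G.rate)⁻¹ * sSup ((fun a => G.bellmanBody v a (max x 0)) '' Icc 0 1)

/-- The properties of value functions that the Bellman operator preserves. -/
structure IsCandidate (v : ℝ → ℝ) : Prop where
  mono : Monotone v
  anti : AntitoneOn (fun x => v x - G.b x) (Ici 0)
  lower : ∀ x, 0 ≤ x → G.b x ≤ v x
  upper : ∀ x, 0 ≤ x → v x ≤ G.b x + G.rate * (G.mu * G.bDeriv 0)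

/-- A solution of the Bellman equation on `[0,∞)`. -/
structure IsSolution (v : ℝ → ℝ) : Prop extends G.IsCandidate v where
  body_le : ∀ x, 0 ≤ x → ∀ a ∈ Icc (0 : ℝ) 1, G.bellmanBody v a x ≤ (1 + G.rate) * v x
  attained : ∀ x, 0 ≤ x → ∃ a ∈ Icc (0 : ℝ) 1, G.bellmanBody v a x = (1 + G.rate) * v x

namespace StandingAssumptions

variable {G} (hG : G.StandingAssumptions)
include hG

lemma b_add_le {x z : ℝ} (hx : 0 ≤ x) (hz : 0 < z) : G.b (x + z) ≤ G.b x + G.bDeriv 0 * z := by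
  have h1 := hG.b_increment_antitone le_rfl hx hz
  have h2 := hG.b_add_sub_le le_rfl hz
  linarith

lemma integrable_value {v : ℝ → ℝ} (hv : G.IsCandidate v) {x : ℝ} (hx : 0 ≤ x) :
    Integrable (fun z => v (x + z)) G.F := by
  refine integrable_of_le_of_le (g₁ := fun _ => G.b x)
    (g₂ := fun z => (G.b x + G.rate * (G.mu * G.bDeriv 0)) + G.bDeriv 0 * z)
    (hv.mono.measurable.comp (measurable_const_add x)).aestronglyMeasurable ?_ ?_
    (integrable_const _) ((integrable_const _).add (G.F_mean.const_mul _))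
  · filter_upwards [G.ae_pos] with z hz
    have hxz : x + z ∈ Ici (0 : ℝ) := by simp only [mem_Ici]; linarith
    exact (hG.b_mono hx hxz (by linarith)).trans (hv.lower _ hxz)
  · filter_upwards [G.ae_pos] with z hz
    have := hv.upper (x + z) (by linarith)
    have := hG.b_add_le hx hz
    linarith

lemma integral_value_le {v : ℝ → ℝ} (hv : G.IsCandidate v) {x : ℝ} (hx : 0 ≤ x) :
    ∫ z, v (x + z) ∂G.F ≤ G.b x + G.rate * (G.mu * G.bDeriv 0) + G.mu * G.bDeriv 0 := by
  have h : ∫ z, v (x + z) ∂G.F ≤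
      ∫ z, (G.b x + G.rate * (G.mu * G.bDeriv 0) + G.bDeriv 0 * z) ∂G.F := by
    refine integral_mono_ae (hG.integrable_value hv hx)
      ((integrable_const _).add (G.F_mean.const_mul _)) ?_
    filter_upwards [G.ae_pos] with z hz
    have := hv.upper (x + z) (by linarith)
    have := hG.b_add_le hx hz
    linarith
  rw [integral_add (integrable_const _) (G.F_mean.const_mul _), integral_const_mul] at h
  simp only [integral_const, probReal_univ, one_smul] at h
  rw [mul_comm (G.bDeriv 0)] at h
  exact h

/-- `E v(x + z) - b(x)` decreases with `x`: it is the mean of `v - b` at `x + z`, which decreases,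
plus the mean of `b(x + z) - b(x)`, which decreases because `b` is concave. -/
lemma integral_value_sub_antitone {v : ℝ → ℝ} (hv : G.IsCandidate v) {x y : ℝ} (hx : 0 ≤ x)
    (hxy : x ≤ y) :
    (∫ z, v (y + z) ∂G.F) - G.b y ≤ (∫ z, v (x + z) ∂G.F) - G.b x := by
  have hy := hx.trans hxy
  have e : ∀ w, 0 ≤ w → (∫ z, v (w + z) ∂G.F) - G.b w = ∫ z, (v (w + z) - G.b w) ∂G.F := by
    intro w hw
    rw [integral_sub (hG.integrable_value hv hw) (integrable_const _)]
    simp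
  rw [e y hy, e x hx]
  refine integral_mono_ae ((hG.integrable_value hv hy).sub (integrable_const _))
    ((hG.integrable_value hv hx).sub (integrable_const _)) ?_
  filter_upwards [G.ae_pos] with z hz
  have h1 := hv.anti (show x + z ∈ Ici (0 : ℝ) by simp only [mem_Ici]; linarith)
    (show y + z ∈ Ici (0 : ℝ) by simp only [mem_Ici]; linarith) (by linarith)
  have h2 := hG.b_increment_antitone hx hxy hz
  simp only at h1 ⊢
  linarith

lemma integral_value_mono {v : ℝ → ℝ} (hv : G.IsCandidate v) {x y : ℝ} (hx : 0 ≤ x)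
    (hxy : x ≤ y) : ∫ z, v (x + z) ∂G.F ≤ ∫ z, v (y + z) ∂G.F :=
  integral_mono (hG.integrable_value hv hx) (hG.integrable_value hv (hx.trans hxy))
    fun _ => hv.mono (by linarith)

lemma continuousOn_bellmanBody (v : ℝ → ℝ) {x : ℝ} (hx : 0 ≤ x) :
    ContinuousOn (fun a => G.bellmanBody v a x) (Icc 0 1) := by
  have := hG.continuousOn_c hx
  simp only [bellmanBody, u_eq]
  fun_prop

lemma bellman_spec (v : ℝ → ℝ) {x : ℝ} (hx : 0 ≤ x) :
    (∀ a ∈ Icc (0 : ℝ) 1, G.bellmanBody v a x ≤ (1 + G.rate) * G.bellman v x) ∧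
    ∃ a ∈ Icc (0 : ℝ) 1, G.bellmanBody v a x = (1 + G.rate) * G.bellman v x := by
  have hr := G.rate_pos
  obtain ⟨a, ha, hmax⟩ := isCompact_Icc.exists_isMaxOn (nonempty_Icc.2 zero_le_one)
    (hG.continuousOn_bellmanBody v hx)
  have hg : IsGreatest ((fun a => G.bellmanBody v a x) '' Icc 0 1) (G.bellmanBody v a x) :=
    ⟨mem_image_of_mem _ ha, by rintro _ ⟨s, hs, rfl⟩; exact hmax hs⟩
  have e : (1 + G.rate) * G.bellman v x = G.bellmanBody v a x := by
    rw [bellman, max_eq_left hx, hg.csSup_eq, mul_inv_cancel_left₀ (by linarith)]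
  rw [e]
  exact ⟨fun s hs => hmax hs, a, ha, rfl⟩

lemma bellman_le_bellman {v w : ℝ → ℝ} (hv : G.IsCandidate v) (hw : G.IsCandidate w)
    (h : ∀ x, 0 ≤ x → v x ≤ w x) {x : ℝ} (hx : 0 ≤ x) : G.bellman v x ≤ G.bellman w x := by
  have hr := G.rate_pos
  obtain ⟨-, a, ha, e⟩ := hG.bellman_spec v hx
  have h1 := (hG.bellman_spec w hx).1 a ha
  have h2 : G.bellmanBody v a x ≤ G.bellmanBody w a x := by
    have := ha.1
    have : (0 : ℝ) ≤ 1 - a := by linarith [ha.2]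
    have h3 : ∫ z, v (x + z) ∂G.F ≤ ∫ z, w (x + z) ∂G.F := by
      refine integral_mono_ae (hG.integrable_value hv hx) (hG.integrable_value hw hx) ?_
      filter_upwards [G.ae_pos] with z hz using h _ (by linarith)
    have h4 := h x hx
    unfold bellmanBody
    gcongr
  rw [e] at h2
  exact le_of_mul_le_mul_left (h2.trans h1) (by linarith)

lemma isCandidate_bellman {v : ℝ → ℝ} (hv : G.IsCandidate v) : G.IsCandidate (G.bellman v) where
  mono := by
    have hr := G.rate_pos
    have key : ∀ x y, 0 ≤ x → x ≤ y → G.bellman v x ≤ G.bellman v y := by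
      intro x y hx hxy
      obtain ⟨-, a, ha, e⟩ := hG.bellman_spec v hx
      have h1 := (hG.bellman_spec v (hx.trans hxy)).1 a ha
      have h2 : G.bellmanBody v a x ≤ G.bellmanBody v a y := by
        have := ha.1
        have : (0 : ℝ) ≤ 1 - a := by linarith [ha.2]
        have h3 := hG.integral_value_mono hv hx hxy
        have h4 := hv.mono hxy
        have h5 : G.u a x ≤ G.u a y := hG.u_mono a ha hx (hx.trans hxy) hxy
        unfold bellmanBody
        gcongr
      rw [e] at h2
      exact le_of_mul_le_mul_left (h2.trans h1) (by linarith)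
    intro x y hxy
    have := key (max x 0) (max y 0) (le_max_right _ _) (max_le_max_right 0 hxy)
    simpa [bellman] using this
  anti := by
    intro x hx y hy hxy
    have hr := G.rate_pos
    obtain ⟨-, a, ha, e⟩ := hG.bellman_spec v hy
    have h1 := (hG.bellman_spec v hx).1 a ha
    have h2 : G.bellmanBody v a y - (1 + G.rate) * G.b y ≤
        G.bellmanBody v a x - (1 + G.rate) * G.b x := by
      have e2 : ∀ w, G.bellmanBody v a w - (1 + G.rate) * G.b w = -G.c a w +
          G.rate * (a * ((∫ z, v (w + z) ∂G.F) - G.b w) + (1 - a) * (v w - G.b w)) := by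
        intro w
        rw [bellmanBody, u_eq]
        ring
      have := ha.1
      have : (0 : ℝ) ≤ 1 - a := by linarith [ha.2]
      have h3 := hG.integral_value_sub_antitone hv hx hxy
      have h4 := hv.anti hx hy hxy
      have h5 := hG.c_le_c ha hx hxy
      simp only at h4
      rw [e2, e2]
      gcongr
    rw [e] at h2
    have h3 : (1 + G.rate) * (G.bellman v y - G.b y) ≤ (1 + G.rate) * (G.bellman v x - G.b x) := by
      linarith
    exact le_of_mul_le_mul_left h3 (by linarith)
  lower := by
    intro x hx
    have hr := G.rate_pos
    have h1 := (hG.bellman_spec v hx).1 0 ⟨le_rfl, zero_le_one⟩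
    have h2 := mul_le_mul_of_nonneg_left (hv.lower x hx) hr.le
    simp only [bellmanBody, u_eq, c_zero] at h1
    have h3 : (1 + G.rate) * G.b x ≤ (1 + G.rate) * G.bellman v x := by linarith
    exact le_of_mul_le_mul_left h3 (by linarith)
  upper := by
    intro x hx
    have hr := G.rate_pos
    have hC : 0 ≤ G.mu * G.bDeriv 0 := mul_nonneg G.mu_nonneg (hG.bDeriv_nonneg le_rfl)
    obtain ⟨-, a, ha, e⟩ := hG.bellman_spec v hx
    have h1 := hG.integral_value_le hv hx
    have h2 : v x ≤ G.b x + G.rate * (G.mu * G.bDeriv 0) + G.mu * G.bDeriv 0 :=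
      (hv.upper x hx).trans (by linarith)
    have h3 := mul_le_mul_of_nonneg_left h1 ha.1
    have h4 := mul_le_mul_of_nonneg_left h2 (sub_nonneg.2 ha.2)
    have h5 := mul_le_mul_of_nonneg_left (add_le_add h3 h4) hr.le
    have h6 := hG.c_nonneg ha hx
    rw [bellmanBody, u_eq] at e
    have h7 : (1 + G.rate) * G.bellman v x ≤
        (1 + G.rate) * (G.b x + G.rate * (G.mu * G.bDeriv 0)) := by
      linarith
    exact le_of_mul_le_mul_left h7 (by linarith)

lemma isCandidate_b : G.IsCandidate (fun x => G.b (max x 0)) where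
  mono := fun x y hxy =>
    hG.b_mono (le_max_right x 0) (le_max_right y 0) (max_le_max_right 0 hxy)
  anti := fun x hx y hy _ => by simp [max_eq_left (mem_Ici.1 hx), max_eq_left (mem_Ici.1 hy)]
  lower := fun x hx => by simp [max_eq_left hx]
  upper := fun x hx => by
    have := mul_nonneg G.rate_pos.le (mul_nonneg G.mu_nonneg (hG.bDeriv_nonneg le_rfl))
    simpa [max_eq_left hx] using this

/-- The Bellman equation has a solution among the candidates, the limit of the increasing iterates
of the Bellman operator started at `b`. -/
theorem exists_isSolution : ∃ v, G.IsSolution v := by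
  have hr := G.rate_pos
  let V : ℕ → ℝ → ℝ := fun k => G.bellman^[k] (fun x => G.b (max x 0))
  have hVs : ∀ k, V (k + 1) = G.bellman (V k) := fun k => Function.iterate_succ_apply' _ _ _
  have hV : ∀ k, G.IsCandidate (V k) := by
    intro k
    induction k with
    | zero => exact hG.isCandidate_b
    | succ k ih => rw [hVs]; exact hG.isCandidate_bellman ih
  have hstep : ∀ k x, 0 ≤ x → V k x ≤ V (k + 1) x := by
    intro k
    induction k with
    | zero =>
      intro x hx
      have := (hV 1).lower x hx
      simpa [V, max_eq_left hx] using this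
    | succ k ih =>
      intro x hx
      rw [hVs k, hVs (k + 1)]
      exact hG.bellman_le_bellman (hV k) (hV (k + 1)) ih hx
  have hmono : ∀ x, 0 ≤ x → Monotone fun k => V k x :=
    fun x hx => monotone_nat_of_le_succ fun k => hstep k x hx
  have hbdd : ∀ x, 0 ≤ x → BddAbove (range fun k => V k x) := by
    rintro x hx
    exact ⟨_, by rintro _ ⟨k, rfl⟩; exact (hV k).upper x hx⟩
  let v : ℝ → ℝ := fun x => ⨆ k, V k (max x 0)
  have hlim : ∀ x, 0 ≤ x → Tendsto (fun k => V k x) atTop (𝓝 (v x)) := by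
    intro x hx
    have := tendsto_atTop_ciSup (hmono x hx) (hbdd x hx)
    simpa [v, max_eq_left hx] using this
  have hle : ∀ k x, 0 ≤ x → V k x ≤ v x := fun k x hx =>
    (hmono x hx).ge_of_tendsto (hlim x hx) k
  have hv : G.IsCandidate v :=
    { mono := fun x y hxy => ciSup_mono (hbdd _ (le_max_right _ _))
        fun k => (hV k).mono (max_le_max_right 0 hxy)
      anti := fun x hx y hy hxy => le_of_tendsto_of_tendsto' ((hlim y hy).sub_const _)
        ((hlim x hx).sub_const _) fun k => (hV k).anti hx hy hxy
      lower := fun x hx => ((hV 0).lower x hx).trans (hle 0 x hx)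
      upper := fun x hx => le_of_tendsto' (hlim x hx) fun k => (hV k).upper x hx }
  suffices h : ∀ x, 0 ≤ x → (∀ a ∈ Icc (0 : ℝ) 1, G.bellmanBody v a x ≤ (1 + G.rate) * v x) ∧
      ∃ a ∈ Icc (0 : ℝ) 1, G.bellmanBody v a x = (1 + G.rate) * v x from
    ⟨v, hv, fun x hx => (h x hx).1, fun x hx => (h x hx).2⟩
  intro x hx
  have hint : Tendsto (fun k => ∫ z, V k (x + z) ∂G.F) atTop (𝓝 (∫ z, v (x + z) ∂G.F)) := by
    refine integral_tendsto_of_tendsto_of_monotone (fun k => hG.integrable_value (hV k) hx)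
      (hG.integrable_value hv hx) ?_ ?_
    · filter_upwards [G.ae_pos] with z hz using hmono _ (by linarith)
    · filter_upwards [G.ae_pos] with z hz using hlim _ (by linarith)
  have hbody : ∀ a, Tendsto (fun k => G.bellmanBody (V k) a x) atTop
      (𝓝 (G.bellmanBody v a x)) := fun a =>
    (((hint.const_mul a).add ((hlim x hx).const_mul (1 - a))).const_mul G.rate).const_add _
  have hub : ∀ a ∈ Icc (0 : ℝ) 1, G.bellmanBody v a x ≤ (1 + G.rate) * v x := by
    intro a ha
    refine le_of_tendsto' (hbody a) fun k => ?_
    refine ((hG.bellman_spec (V k) hx).1 a ha).trans ?_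
    rw [← hVs]
    exact mul_le_mul_of_nonneg_left (hle _ x hx) (by linarith)
  obtain ⟨a, ha, hmax⟩ := isCompact_Icc.exists_isMaxOn (nonempty_Icc.2 zero_le_one)
    (hG.continuousOn_bellmanBody v hx)
  refine ⟨hub, a, ha, le_antisymm (hub a ha) ?_⟩
  refine le_of_tendsto' (((hlim x hx).comp (tendsto_add_atTop_nat 1)).const_mul (1 + G.rate))
    fun k => ?_
  obtain ⟨-, s, hs, e⟩ := hG.bellman_spec (V k) hx
  simp only [Function.comp_apply, hVs]
  rw [← e]
  refine le_trans ?_ (hmax hs)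
  have := hs.1
  have : (0 : ℝ) ≤ 1 - s := by linarith [hs.2]
  have h3 : ∫ z, V k (x + z) ∂G.F ≤ ∫ z, v (x + z) ∂G.F := by
    refine integral_mono_ae (hG.integrable_value (hV k) hx) (hG.integrable_value hv hx) ?_
    filter_upwards [G.ae_pos] with z hz using hle k _ (by linarith)
  have h4 := hle k x hx
  simp only [bellmanBody]
  gcongr

end StandingAssumptions
end Game
end CollectiveInnovation

/-! ### The optimal effort -/

namespace CollectiveInnovation
namespace Game

variable {n : ℕ} (G : Game n)

/-- The social marginal benefit of effort when continuation values are `v`. -/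
noncomputable def price (v : ℝ → ℝ) (x : ℝ) : ℝ := G.rate * ((∫ z, v (x + z) ∂G.F) - v x)

/-- The maximisers over `a ∈ [0,1]` of the net social value of effort when continuation values
are `v`. -/
def maximisers (v : ℝ → ℝ) (x : ℝ) : Set ℝ :=
  {a | a ∈ Icc (0 : ℝ) 1 ∧ IsMaxOn (fun a => a * G.price v x - G.c a x) (Icc 0 1) a}

/-- The smallest maximiser of the net social value of effort, with negative stocks treated as the
stock `0`. -/
noncomputable def optimalEffort (v : ℝ → ℝ) (x : ℝ) : ℝ := sInf (G.maximisers v (max x 0))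

lemma bellmanBody_eq (v : ℝ → ℝ) (a x : ℝ) :
    G.bellmanBody v a x = a * G.price v x - G.c a x + G.b x + G.rate * v x := by
  rw [bellmanBody, u_eq, price]
  ring

lemma IsSolution.net_value {G : Game n} {v : ℝ → ℝ} (hv : G.IsSolution v) {x : ℝ} (hx : 0 ≤ x) :
    (∀ a ∈ Icc (0 : ℝ) 1, a * G.price v x - G.c a x ≤ v x - G.b x) ∧
    ∀ a ∈ G.maximisers v x, a * G.price v x - G.c a x = v x - G.b x := by
  have h1 : ∀ a ∈ Icc (0 : ℝ) 1, a * G.price v x - G.c a x ≤ v x - G.b x := by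
    intro a ha
    have := hv.body_le x hx a ha
    rw [bellmanBody_eq] at this
    linarith
  refine ⟨h1, fun a ha => le_antisymm (h1 a ha.1) ?_⟩
  obtain ⟨s, hs, e⟩ := hv.attained x hx
  rw [bellmanBody_eq] at e
  have := isMaxOn_iff.1 ha.2 s hs
  linarith

namespace StandingAssumptions

variable {G} (hG : G.StandingAssumptions)
include hG

lemma isLeast_optimalEffort (v : ℝ → ℝ) {x : ℝ} (hx : 0 ≤ x) :
    IsLeast (G.maximisers v x) (G.optimalEffort v x) := by
  have hc : ContinuousOn (fun a => a * G.price v x - G.c a x) (Icc 0 1) := by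
    have := hG.continuousOn_c hx
    fun_prop
  obtain ⟨m, hm, hmax⟩ := isCompact_Icc.exists_isMaxOn (nonempty_Icc.2 zero_le_one) hc
  have e : G.maximisers v x =
      Icc 0 1 ∩ (fun a => a * G.price v x - G.c a x) ⁻¹' (Ici (m * G.price v x - G.c m x)) := by
    ext a
    refine and_congr_right fun ha => ⟨fun h => h hm, fun h s hs => ?_⟩
    exact (isMaxOn_iff.1 hmax s hs).trans (mem_Ici.1 h)
  have hcl : IsClosed (G.maximisers v x) := by
    rw [e]
    exact hc.preimage_isClosed_of_isClosed isClosed_Icc isClosed_Ici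
  have hK : IsCompact (G.maximisers v x) :=
    isCompact_Icc.of_isClosed_subset hcl fun a ha => ha.1
  rw [optimalEffort, max_eq_left hx]
  exact hK.isLeast_sInf ⟨m, hm, hmax⟩

lemma optimalEffort_mem (v : ℝ → ℝ) (x : ℝ) : G.optimalEffort v x ∈ Icc (0 : ℝ) 1 := by
  have h := (hG.isLeast_optimalEffort v (le_max_right x 0)).1.1
  simpa [optimalEffort] using h

lemma optimalEffort_le {v : ℝ → ℝ} {a x : ℝ} (hx : 0 ≤ x) (ha : a ∈ Icc (0 : ℝ) 1)
    (h : G.price v x ≤ G.c1 a x) : G.optimalEffort v x ≤ a := by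
  obtain ⟨⟨hm, hmax⟩, hleast⟩ := hG.isLeast_optimalEffort v hx
  by_contra! hlt
  -- the objective decreases beyond `a`, so `a` is as good as the smallest maximiser
  refine absurd (hleast ⟨ha, fun s hs => ?_⟩) (not_le.2 hlt)
  have h1 := hG.c_ge_tangent ha hm hlt.le hx
  have h2 := mul_le_mul_of_nonneg_right h (sub_nonneg.2 hlt.le)
  have h3 := isMaxOn_iff.1 hmax s hs
  simp only [mem_ofPred_eq]
  linarith

lemma bellmanBody_optimalEffort {v : ℝ → ℝ} (hv : G.IsSolution v) {x : ℝ} (hx : 0 ≤ x) :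
    G.bellmanBody v (G.optimalEffort v x) x = (1 + G.rate) * v x := by
  have := (hv.net_value hx).2 _ (hG.isLeast_optimalEffort v hx).1
  rw [bellmanBody_eq]
  linarith

/-- If the smallest maximiser at a stock `y` exceeded the smallest maximiser `a` at a smaller stock
`x`, the marginal benefit of effort at `y` would exceed `c₁(a,y)`, and so `E v(y + z) - b(y)`
would exceed `c₁(a,y) / r + (a c₁(a,y) - c(a,y))`. The first quantity is decreasing in the stock, the second is
increasing, and at `x` they compare the other way round. -/
lemma optimalEffort_antitoneOn {v : ℝ → ℝ} (hv : G.IsSolution v) :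
    AntitoneOn (G.optimalEffort v) (Ici 0) := by
  intro x hx y hy hxy
  have hr := G.rate_pos
  obtain ⟨ha, hmax⟩ := (hG.isLeast_optimalEffort v hx).1
  set a := G.optimalEffort v x with ha_def
  rcases ha.2.eq_or_lt with h1 | h1
  · rw [h1]; exact (hG.optimalEffort_mem v y).2
  refine hG.optimalEffort_le hy ha ?_
  by_contra! hlt
  have hfoc := hG.le_c1_of_isMaxOn ha h1 hx hmax
  have hwx := (hv.net_value hx).2 a ⟨ha, hmax⟩
  have hwy := (hv.net_value hy).1 a ha
  have hR := hG.integral_value_sub_antitone hv.toIsCandidate hx hxy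
  have hrent := hG.rent_le_rent ha hx hxy
  have hc1 : G.c1 a x ≤ G.c1 a y := hG.c1_mono a ha hx hy hxy
  have e : ∀ s, G.rate * ((∫ z, v (s + z) ∂G.F) - G.b s) =
      G.price v s + G.rate * (v s - G.b s) := by
    intro s
    rw [price]; ring
  have h2 := mul_le_mul_of_nonneg_left hR hr.le
  rw [e, e] at h2
  have h3 := mul_le_mul_of_nonneg_left hfoc ha.1
  have h4 := mul_le_mul_of_nonneg_left hlt.le ha.1
  have h5 : G.rate * (v x - G.b x) ≤ G.rate * (v y - G.b y) :=
    mul_le_mul_of_nonneg_left (by linarith) hr.le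
  linarith

lemma optimalEffort_antitone {v : ℝ → ℝ} (hv : G.IsSolution v) : Antitone (G.optimalEffort v) := by
  intro x y hxy
  have := hG.optimalEffort_antitoneOn hv (le_max_right x 0) (le_max_right y 0)
    (max_le_max_right 0 hxy)
  simpa [optimalEffort] using this

lemma price_le {v : ℝ → ℝ} (hv : G.IsSolution v) {x : ℝ} (hx : 0 ≤ x) :
    G.price v x ≤ G.rate * (G.mu * G.bDeriv x) := by
  refine mul_le_mul_of_nonneg_left ?_ G.rate_pos.le
  have h : ∫ z, v (x + z) ∂G.F ≤ ∫ z, (v x + G.bDeriv x * z) ∂G.F := by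
    refine integral_mono_ae (hG.integrable_value hv.toIsCandidate hx)
      ((integrable_const _).add (G.F_mean.const_mul _)) ?_
    filter_upwards [G.ae_pos] with z hz
    have h1 := hv.anti hx (show x + z ∈ Ici (0 : ℝ) by
      simp only [mem_Ici] at hx ⊢; linarith) (by linarith)
    have h2 := hG.b_add_sub_le hx hz
    simp only at h1
    linarith
  rw [integral_add (integrable_const _) (G.F_mean.const_mul _), integral_const_mul] at h
  simp only [integral_const, probReal_univ, one_smul] at h
  rw [mul_comm (G.bDeriv x)] at h
  change _ ≤ v x + G.mu * G.bDeriv x at h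
  linarith

lemma eventually_optimalEffort_le {v : ℝ → ℝ} (hv : G.IsSolution v) {a : ℝ}
    (ha : a ∈ Ioc (0 : ℝ) 1) : ∀ᶠ x in atTop, G.optimalEffort v x ≤ a := by
  obtain ⟨l, hl, hlim⟩ := hG.limit_neg a ha
  filter_upwards [hlim.eventually_lt_const hl, eventually_ge_atTop 0] with x h hx
  refine hG.optimalEffort_le hx ⟨ha.1.le, ha.2⟩ ((hG.price_le hv hx).trans ?_)
  have h' : G.lam * G.mu * n * G.bDeriv x - G.c1 a x < 0 := by exact_mod_cast h
  rw [rate]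
  linarith

lemma tendsto_optimalEffort {v : ℝ → ℝ} (hv : G.IsSolution v) :
    Tendsto (G.optimalEffort v) atTop (𝓝 0) := by
  refine tendsto_order.2 ⟨fun b hb => Eventually.of_forall fun x =>
    hb.trans_le (hG.optimalEffort_mem v x).1, fun b hb => ?_⟩
  have hmem : min (b / 2) 1 ∈ Ioc (0 : ℝ) 1 := ⟨lt_min (by linarith) one_pos, min_le_right _ _⟩
  filter_upwards [hG.eventually_optimalEffort_le hv hmem] with x hx
  have := min_le_left (b / 2) 1
  linarith

lemma tendsto_value_sub_b {v : ℝ → ℝ} (hv : G.IsSolution v) :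
    Tendsto (fun x => v x - G.b x) atTop (𝓝 0) := by
  have h0 : Tendsto (fun x => G.optimalEffort v x * (G.rate * (G.mu * G.bDeriv 0))) atTop
      (𝓝 0) := by
    simpa using (hG.tendsto_optimalEffort hv).mul_const (G.rate * (G.mu * G.bDeriv 0))
  refine tendsto_of_tendsto_of_tendsto_of_le_of_le' tendsto_const_nhds h0 ?_ ?_
  · filter_upwards [eventually_ge_atTop 0] with x hx using sub_nonneg.2 (hv.lower x hx)
  · filter_upwards [eventually_ge_atTop 0] with x hx
    have ha := hG.optimalEffort_mem v x
    rw [← (hv.net_value hx).2 _ (hG.isLeast_optimalEffort v hx).1]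
    have hb : G.bDeriv x ≤ G.bDeriv 0 := by
      have hmono : AntitoneOn G.bDeriv (Ici 0) := hG.b_concave.antitoneOn_derivWithin
        (hG.contDiffOn_b.differentiableOn (by norm_num))
      exact hmono self_mem_Ici hx hx
    have h1 : G.price v x ≤ G.rate * (G.mu * G.bDeriv 0) :=
      (hG.price_le hv hx).trans (mul_le_mul_of_nonneg_left
        (mul_le_mul_of_nonneg_left hb G.mu_nonneg) G.rate_pos.le)
    have h2 := mul_le_mul_of_nonneg_left h1 ha.1
    have h3 := hG.c_nonneg ha hx
    linarith

end StandingAssumptions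
end Game
end CollectiveInnovation

/-! ### Measurability of the path of play and independence of opportunities -/

namespace CollectiveInnovation

section Sigma

variable {ι : Type*} {β : ι → Type*} [∀ i, MeasurableSpace (β i)]

lemma measurableSet_sigma_iff {s : Set (Σ i, β i)} :
    MeasurableSet s ↔ ∀ i, MeasurableSet (Sigma.mk i ⁻¹' s) := by
  unfold Sigma.instMeasurableSpace
  rw [MeasurableSpace.measurableSet_iInf]
  rfl

lemma measurable_sigmaMk (i : ι) : Measurable (Sigma.mk i : β i → Σ i, β i) :=
  fun _ hs => measurableSet_sigma_iff.1 hs i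

lemma measurableEmbedding_sigmaMk (i : ι) :
    MeasurableEmbedding (Sigma.mk i : β i → Σ i, β i) where
  injective := sigma_mk_injective
  measurable := measurable_sigmaMk i
  measurableSet_image' := by
    intro s hs
    refine measurableSet_sigma_iff.2 fun j => ?_
    rcases eq_or_ne i j with rfl | hij
    · rwa [preimage_image_eq _ sigma_mk_injective]
    · rw [preimage_image_sigmaMk_of_ne hij.symm]
      exact MeasurableSet.empty

/-- A function of a point of a countable disjoint union and of a parameter is jointly measurable if
it is so on each summand. -/
lemma measurable_sigma_prod [Countable ι] {γ δ : Type*} [MeasurableSpace γ] [MeasurableSpace δ]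
    {f : (Σ i, β i) × γ → δ} (hf : ∀ i, Measurable fun p : β i × γ => f (⟨i, p.1⟩, p.2)) :
    Measurable f := by
  intro s hs
  have e : f ⁻¹' s = ⋃ i, Prod.map (Sigma.mk i) (id : γ → γ) ''
      ((fun p : β i × γ => f (⟨i, p.1⟩, p.2)) ⁻¹' s) := by
    ext ⟨⟨i, x⟩, y⟩
    simp only [mem_preimage, mem_iUnion, mem_image, Prod.exists, Prod.map_apply, id_eq,
      Prod.mk.injEq]
    constructor
    · exact fun h => ⟨i, x, y, h, rfl, rfl⟩
    · rintro ⟨j, x', y', h, h1, rfl⟩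
      rw [← h1]; exact h
  rw [e]
  exact MeasurableSet.iUnion fun i =>
    ((measurableEmbedding_sigmaMk i).prodMap MeasurableEmbedding.id).measurableSet_image.2
      (hf i hs)

lemma measurable_sigma [Countable ι] {δ : Type*} [MeasurableSpace δ]
    {f : (Σ i, β i) → δ} (hf : ∀ i, Measurable fun x : β i => f ⟨i, x⟩) : Measurable f :=
  fun _ hs => measurableSet_sigma_iff.2 fun i => hf i hs

end Sigma

variable {n : ℕ}

lemma measurable_arrival (k : ℕ) : Measurable fun ω : Sample n => arrival ω k := by
  unfold arrival
  fun_prop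

lemma arrival_succ (ω : Sample n) (k : ℕ) : arrival ω (k + 1) = arrival ω k + (ω k).1 :=
  Finset.sum_range_succ _ _

lemma History.stock_append {m : ℕ} (h : History n m) (e : Innovation n) :
    (h.append e).stock = h.stock + e.2.1 := by
  simp only [stock, append]
  rw [Fin.sum_univ_castSucc]
  simp [add_assoc]

lemma History.measurable_append {m : ℕ} :
    Measurable fun p : History n m × Innovation n => p.1.append p.2 := by
  refine (measurable_fst.comp measurable_fst).prodMk (measurable_pi_iff.2 fun l => ?_)
  refine Fin.lastCases ?_ (fun l => ?_) l
  · simpa using measurable_snd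
  · simp only [Fin.snoc_castSucc]
    fun_prop

/-- The history that follows `h` when the opportunity `o` arrives at time `t`. -/
noncomputable def step (σ : Fin n → Strategy n) (h : Σ m, History n m) (t : ℝ) (o : Opportunity n) :
    Σ m, History n m :=
  if (o.2.2.1 : ℝ) ≤ (σ o.2.1).effort h.1 h.2 t then
    ⟨h.1 + 1, h.2.append (t, o.2.2.2, o.2.1)⟩
  else h

lemma reached_succ (σ : Fin n → Strategy n) (x₀ : ℝ) (ω : Sample n) (k : ℕ) :
    reached σ x₀ ω (k + 1) = step σ (reached σ x₀ ω k) (arrival ω (k + 1)) (ω k) := rfl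

lemma stock_step (σ : Fin n → Strategy n) (h : Σ m, History n m) (t : ℝ) (o : Opportunity n) :
    (step σ h t o).2.stock =
      if (o.2.2.1 : ℝ) ≤ (σ o.2.1).effort h.1 h.2 t then h.2.stock + o.2.2.2 else h.2.stock := by
  unfold step
  by_cases hc : (o.2.2.1 : ℝ) ≤ (σ o.2.1).effort h.1 h.2 t
  · rw [if_pos hc, if_pos hc]
    exact History.stock_append _ _
  · rw [if_neg hc, if_neg hc]

lemma measurable_stock_sigma : Measurable fun h : (Σ m, History n m) => h.2.stock :=
  measurable_sigma fun _ => History.measurable_stock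

lemma Strategy.measurable_effort (s : Strategy n) :
    Measurable fun p : (Σ m, History n m) × ℝ => s.effort p.1.1 p.1.2 p.2 :=
  measurable_sigma_prod fun m => s.measurable m

lemma measurable_step (σ : Fin n → Strategy n) :
    Measurable fun p : (Σ m, History n m) × (ℝ × Opportunity n) => step σ p.1 p.2.1 p.2.2 := by
  refine measurable_sigma_prod fun m => ?_
  have heff : Measurable fun p : History n m × (ℝ × Opportunity n) =>
      (σ p.2.2.2.1).effort m p.1 p.2.1 := by
    have : Measurable fun q : Fin n × (History n m × ℝ) => (σ q.1).effort m q.2.1 q.2.2 :=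
      measurable_from_prod_countable_right fun i => (σ i).measurable m
    exact this.comp (f := fun p : History n m × (ℝ × Opportunity n) =>
      (p.2.2.2.1, (p.1, p.2.1))) (by fun_prop)
  refine Measurable.ite (measurableSet_le (by fun_prop) heff) ?_ ?_
  · exact (measurable_sigmaMk (m + 1)).comp (History.measurable_append.comp
      (f := fun p : History n m × (ℝ × Opportunity n) => (p.1, (p.2.1, p.2.2.2.2.2, p.2.2.2.1)))
      (by fun_prop))
  · exact (measurable_sigmaMk m).comp measurable_fst

lemma measurable_reached (σ : Fin n → Strategy n) (x₀ : ℝ) (k : ℕ) :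
    Measurable fun ω : Sample n => reached σ x₀ ω k := by
  induction k with
  | zero => exact measurable_const
  | succ k ih =>
    simp only [reached_succ]
    exact (measurable_step σ).comp (ih.prodMk ((measurable_arrival _).prodMk (by fun_prop)))

lemma arrival_update (ω : Sample n) (k : ℕ) (y : Opportunity n) {j : ℕ} (hj : j ≤ k) :
    arrival (Function.update ω k y) j = arrival ω j := by
  refine Finset.sum_congr rfl fun i hi => ?_
  rw [Function.update_of_ne]
  have := Finset.mem_range.1 hi
  omega

lemma arrival_update_succ (ω : Sample n) (k : ℕ) (y : Opportunity n) :
    arrival (Function.update ω k y) (k + 1) = arrival ω k + y.1 := by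
  rw [arrival_succ, arrival_update ω k y le_rfl, Function.update_self]

lemma reached_update (σ : Fin n → Strategy n) (x₀ : ℝ) (ω : Sample n) (k : ℕ) (y : Opportunity n)
    {j : ℕ} (hj : j ≤ k) : reached σ x₀ (Function.update ω k y) j = reached σ x₀ ω j := by
  induction j with
  | zero => rfl
  | succ j ih =>
    rw [reached_succ, reached_succ, ih (by omega), arrival_update ω k y hj,
      Function.update_of_ne (by omega)]

lemma reached_update_succ (σ : Fin n → Strategy n) (x₀ : ℝ) (ω : Sample n) (k : ℕ)
    (y : Opportunity n) : reached σ x₀ (Function.update ω k y) (k + 1) =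
      step σ (reached σ x₀ ω k) (arrival ω k + y.1) y := by
  rw [reached_succ, reached_update σ x₀ ω k y le_rfl, arrival_update_succ, Function.update_self]

namespace Game

variable (G : Game n)

instance instIsProbabilityMeasureP : IsProbabilityMeasure G.P := by
  unfold P
  infer_instance

lemma isProbabilityMeasure_waiting : IsProbabilityMeasure (expMeasure (n * G.lam)) :=
  isProbabilityMeasure_expMeasure G.rate_pos

/-- Redrawing the `k`-th opportunity does not change the law of the sequence. This is how the
independence of an opportunity from the preceding ones is used. -/
lemma measurePreserving_update (k : ℕ) :
    MeasurePreserving (fun p : Sample n × Opportunity n => Function.update p.1 k p.2)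
      (G.P.prod G.opportunityLaw) G.P := by
  have hm : Measurable fun p : Sample n × Opportunity n => Function.update p.1 k p.2 := by
    refine measurable_pi_iff.2 fun j => ?_
    rcases eq_or_ne j k with rfl | hj
    · simpa using measurable_snd
    · simp only [Function.update_of_ne hj]
      fun_prop
  refine ⟨hm, Measure.eq_infinitePi _ fun s t ht => ?_⟩
  rw [Measure.map_apply hm (MeasurableSet.pi s.countable_toSet fun i _ => ht i)]
  have e : (fun p : Sample n × Opportunity n => Function.update p.1 k p.2) ⁻¹' (s : Set ℕ).pi t =
      ((s.erase k : Finset ℕ) : Set ℕ).pi t ×ˢ (if k ∈ s then t k else univ) := by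
    ext ⟨ω, y⟩
    simp only [mem_preimage, Set.mem_pi, mem_prod, Finset.coe_erase, Set.mem_sdiff, Finset.mem_coe,
      mem_singleton_iff]
    constructor
    · intro h
      refine ⟨fun i hi => ?_, ?_⟩
      · simpa [Function.update_of_ne hi.2] using h i hi.1
      · split_ifs with hk
        · simpa using h k hk
        · trivial
    · rintro ⟨h1, h2⟩ i hi
      rcases eq_or_ne i k with rfl | hik
      · simpa [hi] using h2
      · simpa [Function.update_of_ne hik] using h1 i ⟨hi, hik⟩
  rw [e, Measure.prod_prod, P, Measure.infinitePi_pi _ fun i _ => ht i]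
  by_cases hk : k ∈ s
  · rw [if_pos hk, Finset.prod_erase_mul s (fun i => G.opportunityLaw (t i)) hk]
  · rw [if_neg hk, measure_univ, mul_one, Finset.erase_eq_of_notMem hk]

lemma lintegral_update (k : ℕ) {g : Sample n → ENNReal} (hg : Measurable g) :
    ∫⁻ ω, g ω ∂G.P = ∫⁻ ω, ∫⁻ y, g (Function.update ω k y) ∂G.opportunityLaw ∂G.P := by
  have h := G.measurePreserving_update k
  rw [← h.lintegral_comp hg]
  exact lintegral_prod _ (hg.comp h.measurable).aemeasurable

lemma lintegral_uniformOn_univ (f : Fin n → ENNReal) :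
    ∫⁻ i, f i ∂(uniformOn (univ : Set (Fin n))) = (n : ENNReal)⁻¹ * ∑ i, f i := by
  rw [uniformOn, ProbabilityTheory.cond, lintegral_smul_measure, Measure.restrict_univ, lintegral_count]
  simp [Measure.count_univ]

/-- Integration against the law of an opportunity, one coordinate at a time. -/
lemma lintegral_opportunityLaw {f : Opportunity n → ENNReal} (hf : Measurable f) :
    ∫⁻ y, f y ∂G.opportunityLaw = ∫⁻ s, (n : ENNReal)⁻¹ *
      ∑ i, ∫⁻ m : unitInterval, ∫⁻ z, f (s, i, m, z) ∂G.F ∂volume ∂(expMeasure (n * G.lam)) := by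
  have := G.isProbabilityMeasure_waiting
  have : Nonempty (Fin n) := ⟨⟨0, lt_of_lt_of_le (by norm_num) G.two_le⟩⟩
  rw [opportunityLaw, lintegral_prod _ hf.aemeasurable]
  refine lintegral_congr fun s => ?_
  rw [lintegral_prod _ (by fun_prop), lintegral_uniformOn_univ]
  congr 1
  refine Finset.sum_congr rfl fun i _ => ?_
  rw [lintegral_prod _ (by fun_prop)]

lemma lintegral_opportunityLaw_fst {f : ℝ → ENNReal} (hf : Measurable f) :
    ∫⁻ y, f y.1 ∂G.opportunityLaw = ∫⁻ s, f s ∂(expMeasure (n * G.lam)) := by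
  have := G.isProbabilityMeasure_waiting
  have : Nonempty (Fin n) := ⟨⟨0, lt_of_lt_of_le (by norm_num) G.two_le⟩⟩
  rw [opportunityLaw, lintegral_prod _ (by fun_prop)]
  simp

lemma lintegral_accept {a : ℝ} (ha : a ∈ Icc (0 : ℝ) 1) (V : ℝ → ENNReal) (x : ℝ) :
    ∫⁻ m : unitInterval, ∫⁻ z, V (if (m : ℝ) ≤ a then x + z else x) ∂G.F =
      ENNReal.ofReal a * (∫⁻ z, V (x + z) ∂G.F) + ENNReal.ofReal (1 - a) * V x := by
  have e : ∀ m : unitInterval, ∫⁻ z, V (if (m : ℝ) ≤ a then x + z else x) ∂G.F =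
      (Iic (⟨a, ha⟩ : unitInterval)).indicator (fun _ => ∫⁻ z, V (x + z) ∂G.F) m +
      (Ioi (⟨a, ha⟩ : unitInterval)).indicator (fun _ => V x) m := by
    intro m
    by_cases hm : (m : ℝ) ≤ a
    · have h1 : m ∈ Iic (⟨a, ha⟩ : unitInterval) := hm
      have h2 : m ∉ Ioi (⟨a, ha⟩ : unitInterval) := not_lt.2 hm
      simp [hm, indicator_of_mem h1, indicator_of_notMem h2]
    · have h1 : m ∉ Iic (⟨a, ha⟩ : unitInterval) := hm
      have h2 : m ∈ Ioi (⟨a, ha⟩ : unitInterval) := not_le.1 hm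
      simp [hm, indicator_of_notMem h1, indicator_of_mem h2]
  simp_rw [e]
  rw [lintegral_add_left (measurable_const.indicator measurableSet_Iic),
    lintegral_indicator measurableSet_Iic, lintegral_indicator measurableSet_Ioi]
  simp [mul_comm]

lemma ae_pos_expMeasure {r : ℝ} (hr : 0 < r) : ∀ᵐ s ∂(expMeasure r), 0 < s := by
  have := isProbabilityMeasure_expMeasure hr
  rw [ae_iff]
  have : {s : ℝ | ¬ 0 < s} = Iic 0 := by ext; simp
  rw [this, ← ofReal_cdf, cdf_expMeasure_eq hr]
  simp

lemma ae_opportunityLaw : ∀ᵐ y ∂G.opportunityLaw, 0 < y.1 ∧ 0 < y.2.2.2 := by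
  have := G.isProbabilityMeasure_waiting
  have : Nonempty (Fin n) := ⟨⟨0, lt_of_lt_of_le (by norm_num) G.two_le⟩⟩
  have h1 : ∀ᵐ y ∂G.opportunityLaw, 0 < y.1 :=
    Measure.quasiMeasurePreserving_fst.ae (ae_pos_expMeasure G.rate_pos)
  have h2 : ∀ᵐ y ∂G.opportunityLaw, 0 < y.2.2.2 :=
    Measure.quasiMeasurePreserving_snd.ae (Measure.quasiMeasurePreserving_snd.ae
      (Measure.quasiMeasurePreserving_snd.ae G.ae_pos))
  exact h1.and h2

lemma ae_forall_pos : ∀ᵐ ω ∂G.P, ∀ j, 0 < (ω j).1 ∧ 0 < (ω j).2.2.2 :=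
  ae_all_iff.2 fun j => (measurePreserving_eval_infinitePi (fun _ : ℕ => G.opportunityLaw)
    j).quasiMeasurePreserving.ae G.ae_opportunityLaw

/-- By the second Borel–Cantelli lemma, opportunities of a type that has positive probability
recur. -/
lemma ae_frequently_mem {A : Set (Opportunity n)} (hA : MeasurableSet A)
    (hpos : G.opportunityLaw A ≠ 0) : ∀ᵐ ω ∂G.P, ∃ᶠ j in atTop, ω j ∈ A := by
  have hs : ∀ j : ℕ, MeasurableSet {ω : Sample n | ω j ∈ A} := fun j => measurable_pi_apply j hA
  have hP : ∀ j : ℕ, G.P {ω : Sample n | ω j ∈ A} = G.opportunityLaw A := fun j =>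
    (measurePreserving_eval_infinitePi (fun _ : ℕ => G.opportunityLaw) j).measure_preimage
      hA.nullMeasurableSet
  have hind : iIndepSet (fun j : ℕ => {ω : Sample n | ω j ∈ A}) G.P := by
    rw [iIndepSet_iff_meas_biInter hs]
    intro s
    have e : (⋂ i ∈ s, {ω : Sample n | ω i ∈ A}) = (s : Set ℕ).pi fun _ => A := by
      ext ω; simp [Set.mem_pi]
    rw [e, Finset.prod_congr rfl fun i _ => hP i, P]
    exact Measure.infinitePi_pi _ fun _ _ => hA
  have h1 := measure_limsup_eq_one hs hind (by
    simp_rw [hP]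
    exact ENNReal.tsum_const_eq_top_of_ne_zero hpos)
  have h2 : ∀ᵐ ω ∂G.P, ω ∈ limsup (fun j : ℕ => {ω : Sample n | ω j ∈ A}) atTop :=
    (prob_compl_eq_zero_iff (MeasurableSet.measurableSet_limsup hs)).2 h1
  filter_upwards [h2] with ω hω
  exact mem_limsup_iff_frequently_mem.1 hω

end Game
end CollectiveInnovation

/-! ### The welfare supermartingale -/

namespace CollectiveInnovation

section Exponential

variable {r : ℝ}

lemma measurable_exponentialPDF (r : ℝ) : Measurable (exponentialPDF r) :=
  (measurable_exponentialPDFReal r).ennreal_ofReal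

lemma lintegral_expMeasure (r : ℝ) {g : ℝ → ENNReal} (hg : Measurable g) :
    ∫⁻ s, g s ∂(expMeasure r) = ∫⁻ s, exponentialPDF r s * g s := by
  have : expMeasure r = volume.withDensity (exponentialPDF r) := rfl
  rw [this, lintegral_withDensity_eq_lintegral_mul _ (measurable_exponentialPDF r) hg]
  rfl

lemma lintegral_exp_neg_expMeasure (hr : 0 < r) :
    ENNReal.ofReal (1 + r) * ∫⁻ s, ENNReal.ofReal (Real.exp (-s)) ∂(expMeasure r) =
      ENNReal.ofReal r := by
  have hm : Measurable fun s => exponentialPDF r s * ENNReal.ofReal (Real.exp (-s)) :=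
    (measurable_exponentialPDF r).mul (by fun_prop)
  rw [lintegral_expMeasure r (by fun_prop), ← lintegral_const_mul _ hm]
  have e : ∀ s, ENNReal.ofReal (1 + r) * (exponentialPDF r s * ENNReal.ofReal (Real.exp (-s))) =
      ENNReal.ofReal r * exponentialPDF (1 + r) s := by
    intro s
    rw [exponentialPDF_eq, exponentialPDF_eq]
    split_ifs
    · rw [← ENNReal.ofReal_mul (by positivity), ← ENNReal.ofReal_mul (by positivity),
        ← ENNReal.ofReal_mul (by positivity)]
      congr 1
      rw [show -((1 + r) * s) = -(r * s) + -s by ring, Real.exp_add]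
      ring
    · simp
  simp_rw [e]
  rw [lintegral_const_mul _ (measurable_exponentialPDF _),
    lintegral_exponentialPDF_eq_one (by linarith), mul_one]

lemma expMeasure_Ioi (hr : 0 < r) {c : ℝ} (hc : 0 ≤ c) :
    expMeasure r (Ioi c) = ENNReal.ofReal (Real.exp (-(r * c))) := by
  have := isProbabilityMeasure_expMeasure hr
  rw [← compl_Iic, prob_compl_eq_one_sub measurableSet_Iic, ← ofReal_cdf, cdf_expMeasure_eq hr,
    if_pos hc, ← ENNReal.ofReal_one, ← ENNReal.ofReal_sub]
  · congr 1; ring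
  · have : Real.exp (-(r * c)) ≤ 1 := Real.exp_le_one_iff.2 (by nlinarith)
    linarith

/-- Poisson arrivals see time averages: the expected integral of `g` until the next opportunity is
the expected value of `g` at that opportunity, divided by the arrival rate. -/
lemma lintegral_until_arrival (hr : 0 < r) {T : ℝ} (hT : 0 ≤ T) {g : ℝ → ENNReal}
    (hg : Measurable g) :
    ENNReal.ofReal r * ∫⁻ s, (∫⁻ t in Ioi (0 : ℝ), (Ico T (T + s)).indicator g t) ∂(expMeasure r) =
      ∫⁻ s, g (T + s) ∂(expMeasure r) := by
  have := isProbabilityMeasure_expMeasure hr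
  have e1 : ∀ s t, (Ico T (T + s)).indicator g t =
      (Ici T).indicator g t * (Ioi (t - T)).indicator 1 s := by
    intro s t
    by_cases h1 : T ≤ t <;> by_cases h2 : t < T + s
    · rw [indicator_of_mem (show t ∈ Ico T (T + s) from ⟨h1, h2⟩),
        indicator_of_mem (show t ∈ Ici T from h1),
        indicator_of_mem (show s ∈ Ioi (t - T) by simp only [mem_Ioi]; linarith)]
      simp
    · rw [indicator_of_notMem (fun h => h2 h.2),
        indicator_of_notMem (show s ∉ Ioi (t - T) by simp only [mem_Ioi]; linarith)]
      simp
    · rw [indicator_of_notMem (fun h => h1 h.1),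
        indicator_of_notMem (show t ∉ Ici T from h1)]
      simp
    · rw [indicator_of_notMem (fun h => h1 h.1),
        indicator_of_notMem (show t ∉ Ici T from h1)]
      simp
  have hm : Measurable fun p : ℝ × ℝ => (Ici T).indicator g p.2 * (Ioi (p.2 - T)).indicator 1 p.1 := by
    refine ((hg.indicator measurableSet_Ici).comp measurable_snd).mul ?_
    have : (fun p : ℝ × ℝ => (Ioi (p.2 - T)).indicator (1 : ℝ → ENNReal) p.1) =
        {p : ℝ × ℝ | p.2 - T < p.1}.indicator 1 := by
      ext p; simp [indicator_apply]
    rw [this]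
    exact measurable_one.indicator (measurableSet_lt (by fun_prop) (by fun_prop))
  have h0 : volume.restrict (Ioi (0 : ℝ)) = volume.restrict (Ici 0) :=
    Measure.restrict_congr_set Ioi_ae_eq_Ici
  simp_rw [e1]
  rw [h0, lintegral_lintegral_swap hm.aemeasurable, lintegral_expMeasure r (by fun_prop),
    ← lintegral_sub_right_eq_self (μ := volume) (fun s => exponentialPDF r s * g (T + s)) T,
    ← lintegral_const_mul _ ?_, ← lintegral_indicator measurableSet_Ici]
  · refine lintegral_congr fun t => ?_
    have e2 : ∫⁻ s, (Ici T).indicator g t * (Ioi (t - T)).indicator 1 s ∂(expMeasure r) =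
        (Ici T).indicator g t * expMeasure r (Ioi (t - T)) := by
      rw [lintegral_const_mul _ (measurable_one.indicator measurableSet_Ioi),
        lintegral_indicator_one measurableSet_Ioi]
    rw [add_sub_cancel, exponentialPDF_eq]
    by_cases h : T ≤ t
    · rw [indicator_of_mem (show t ∈ Ici 0 from hT.trans h), e2,
        indicator_of_mem (show t ∈ Ici T from h), if_pos (sub_nonneg.2 h),
        expMeasure_Ioi hr (sub_nonneg.2 h), ENNReal.ofReal_mul hr.le]
      ring
    · rw [if_neg (by linarith), ENNReal.ofReal_zero, zero_mul]
      refine indicator_apply_eq_zero.2 fun _ => ?_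
      rw [e2, indicator_of_notMem (show t ∉ Ici T from h)]
      simp
  · exact Measurable.lintegral_prod_left hm

end Exponential

variable {n : ℕ}

/-- The discount factor at the arrival of the `k`-th opportunity. -/
noncomputable def discount (ω : Sample n) (k : ℕ) : ENNReal :=
  ENNReal.ofReal (Real.exp (-arrival ω k))

lemma measurable_discount (k : ℕ) : Measurable fun ω : Sample n => discount ω k :=
  ((measurable_arrival k).neg.exp).ennreal_ofReal

/-- The stock after the first `k` opportunities. -/
noncomputable def stockSeq (σ : Fin n → Strategy n) (x₀ : ℝ) (ω : Sample n) (k : ℕ) : ℝ :=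
  (reached σ x₀ ω k).2.stock

/-- The effort that agent `i` exerts when the opportunity following the first `k` ones arrives. -/
noncomputable def effortSeq (σ : Fin n → Strategy n) (i : Fin n) (x₀ : ℝ) (ω : Sample n) (k : ℕ) :
    ℝ :=
  (σ i).effort _ (reached σ x₀ ω k).2 (arrival ω (k + 1))

lemma measurable_stockSeq (σ : Fin n → Strategy n) (x₀ : ℝ) (k : ℕ) :
    Measurable fun ω => stockSeq σ x₀ ω k :=
  measurable_stock_sigma.comp (measurable_reached σ x₀ k)

lemma measurable_effortSeq (σ : Fin n → Strategy n) (i : Fin n) (x₀ : ℝ) (k : ℕ) :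
    Measurable fun ω => effortSeq σ i x₀ ω k :=
  (σ i).measurable_effort.comp ((measurable_reached σ x₀ k).prodMk (measurable_arrival (k + 1)))

lemma effortSeq_mem (σ : Fin n → Strategy n) (i : Fin n) (x₀ : ℝ) (ω : Sample n) (k : ℕ) :
    effortSeq σ i x₀ ω k ∈ Icc (0 : ℝ) 1 := (σ i).mem_Icc _ _ _

lemma stockSeq_zero (σ : Fin n → Strategy n) (x₀ : ℝ) (ω : Sample n) : stockSeq σ x₀ ω 0 = x₀ := by
  change x₀ + ∑ l : Fin 0, _ = x₀
  simp

lemma stockSeq_succ (σ : Fin n → Strategy n) (x₀ : ℝ) (ω : Sample n) (k : ℕ) :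
    stockSeq σ x₀ ω (k + 1) =
      if ((ω k).2.2.1 : ℝ) ≤ effortSeq σ (ω k).2.1 x₀ ω k then
        stockSeq σ x₀ ω k + (ω k).2.2.2 else stockSeq σ x₀ ω k := by
  rw [stockSeq, reached_succ, stock_step]
  rfl

lemma monotone_stockSeq (σ : Fin n → Strategy n) (x₀ : ℝ) {ω : Sample n}
    (hω : ∀ j, 0 < (ω j).1 ∧ 0 < (ω j).2.2.2) : Monotone (stockSeq σ x₀ ω) := by
  refine monotone_nat_of_le_succ fun k => ?_
  rw [stockSeq_succ]
  split_ifs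
  · linarith [(hω k).2]
  · exact le_rfl

lemma stockSeq_nonneg (σ : Fin n → Strategy n) {x₀ : ℝ} (hx₀ : 0 ≤ x₀) {ω : Sample n}
    (hω : ∀ j, 0 < (ω j).1 ∧ 0 < (ω j).2.2.2) (k : ℕ) : 0 ≤ stockSeq σ x₀ ω k := by
  have := monotone_stockSeq σ x₀ hω (Nat.zero_le k)
  rw [stockSeq_zero] at this
  exact hx₀.trans this

lemma stockSeq_update_succ (σ : Fin n → Strategy n) (x₀ : ℝ) (ω : Sample n) (k : ℕ)
    (y : Opportunity n) : stockSeq σ x₀ (Function.update ω k y) (k + 1) =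
      (step σ (reached σ x₀ ω k) (arrival ω k + y.1) y).2.stock := by
  rw [stockSeq, reached_update_succ]

namespace Game

variable (G : Game n)

/-- The next waiting time can be integrated out, given the history reached so far. -/
lemma lintegral_next_arrival (σ : Fin n → Strategy n) (x₀ : ℝ) (k : ℕ)
    {φ : (Σ m, History n m) × ℝ → ENNReal} (hφ : Measurable φ) :
    ∫⁻ ω, φ (reached σ x₀ ω k, arrival ω (k + 1)) ∂G.P =
      ∫⁻ ω, ∫⁻ s, φ (reached σ x₀ ω k, arrival ω k + s) ∂(expMeasure (n * G.lam)) ∂G.P := by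
  have hm : Measurable fun ω => φ (reached σ x₀ ω k, arrival ω (k + 1)) :=
    hφ.comp ((measurable_reached σ x₀ k).prodMk (measurable_arrival _))
  rw [G.lintegral_update k hm]
  refine lintegral_congr fun ω => ?_
  simp_rw [reached_update σ x₀ ω k _ le_rfl, arrival_update_succ]
  exact G.lintegral_opportunityLaw_fst (f := fun s => φ (reached σ x₀ ω k, arrival ω k + s))
    (by fun_prop)

/-- The waiting time to the next opportunity multiplies the expected discount factor by
`r / (1 + r)`. -/
lemma discount_succ_mul (σ : Fin n → Strategy n) (x₀ : ℝ) (k : ℕ)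
    {V : ℝ → ENNReal} (hV : Measurable V) :
    ENNReal.ofReal (1 + G.rate) * ∫⁻ ω, discount ω (k + 1) * V (stockSeq σ x₀ ω k) ∂G.P =
      ENNReal.ofReal G.rate * ∫⁻ ω, discount ω k * V (stockSeq σ x₀ ω k) ∂G.P := by
  have h := G.lintegral_next_arrival σ x₀ k
    (φ := fun p => ENNReal.ofReal (Real.exp (-p.2)) * V p.1.2.stock)
    ((by fun_prop : Measurable fun p : (Σ m, History n m) × ℝ =>
      ENNReal.ofReal (Real.exp (-p.2))).mul
        (hV.comp (measurable_stock_sigma.comp measurable_fst)))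
  have e : ∀ ω : Sample n, ∫⁻ s, ENNReal.ofReal (Real.exp (-(arrival ω k + s))) *
        V (reached σ x₀ ω k).2.stock ∂(expMeasure (n * G.lam)) =
      (discount ω k * V (stockSeq σ x₀ ω k)) *
        ∫⁻ s, ENNReal.ofReal (Real.exp (-s)) ∂(expMeasure (n * G.lam)) := by
    intro ω
    rw [← lintegral_const_mul _ (by fun_prop)]
    refine lintegral_congr fun s => ?_
    rw [neg_add, Real.exp_add, ENNReal.ofReal_mul (Real.exp_pos _).le, discount, stockSeq]
    ring
  simp_rw [e] at h
  have hm : Measurable fun ω => discount ω k * V (stockSeq σ x₀ ω k) :=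
    (measurable_discount k).mul (hV.comp (measurable_stockSeq σ x₀ k))
  rw [lintegral_mul_const _ hm] at h
  change ∫⁻ ω, discount ω (k + 1) * V (stockSeq σ x₀ ω k) ∂G.P = _ at h
  have hl := lintegral_exp_neg_expMeasure G.rate_pos
  rw [rate] at hl ⊢
  rw [h, ← hl]
  ring

/-- The expected value of `V` at the stock that follows an opportunity, when the stock is `x` and
agent `i` exerts effort `a i`. -/
noncomputable def expectedNext (V : ℝ → ENNReal) (a : Fin n → ℝ) (x : ℝ) : ENNReal :=
  (n : ENNReal)⁻¹ * ∑ i, (ENNReal.ofReal (a i) * (∫⁻ z, V (x + z) ∂G.F) +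
    ENNReal.ofReal (1 - a i) * V x)

lemma measurable_lintegral_add {V : ℝ → ENNReal} (hV : Measurable V) :
    Measurable fun x => ∫⁻ z, V (x + z) ∂G.F :=
  Measurable.lintegral_prod_right' (f := fun p : ℝ × ℝ => V (p.1 + p.2)) (by fun_prop)

/-- The agent, mark and size of the next opportunity can be integrated out, given its arrival time
and the history reached so far. -/
lemma lintegral_discount_succ (σ : Fin n → Strategy n) (x₀ : ℝ) (k : ℕ)
    {V : ℝ → ENNReal} (hV : Measurable V) :
    ∫⁻ ω, discount ω (k + 1) * V (stockSeq σ x₀ ω (k + 1)) ∂G.P =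
      ∫⁻ ω, discount ω (k + 1) *
        G.expectedNext V (fun i => effortSeq σ i x₀ ω k) (stockSeq σ x₀ ω k) ∂G.P := by
  have hint := G.measurable_lintegral_add hV
  have hst : Measurable fun p : (Σ m, History n m) × ℝ => p.1.2.stock :=
    measurable_stock_sigma.comp measurable_fst
  have hφ : Measurable fun p : (Σ m, History n m) × ℝ => ENNReal.ofReal (Real.exp (-p.2)) *
      G.expectedNext V (fun i => (σ i).effort _ p.1.2 p.2) p.1.2.stock := by
    refine Measurable.mul (by fun_prop) (Measurable.const_mul ?_ _)
    refine Finset.measurable_sum _ fun i _ => ?_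
    have h := (σ i).measurable_effort
    exact (h.ennreal_ofReal.mul (hint.comp hst)).add
      ((h.const_sub 1).ennreal_ofReal.mul (hV.comp hst))
  refine Eq.trans ?_ (G.lintegral_next_arrival σ x₀ k hφ).symm
  have hm₀ : Measurable fun ω => discount ω (k + 1) * V (stockSeq σ x₀ ω (k + 1)) :=
    (measurable_discount _).mul (hV.comp (measurable_stockSeq σ x₀ _))
  rw [G.lintegral_update k hm₀]
  refine lintegral_congr fun ω => ?_
  simp_rw [discount, arrival_update_succ, stockSeq_update_succ]
  have hm : Measurable fun y : Opportunity n => ENNReal.ofReal (Real.exp (-(arrival ω k + y.1))) *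
      V (step σ (reached σ x₀ ω k) (arrival ω k + y.1) y).2.stock := by
    have hs : Measurable fun y : Opportunity n =>
        step σ (reached σ x₀ ω k) (arrival ω k + y.1) y :=
      (measurable_step σ).comp (f := fun y : Opportunity n =>
        (reached σ x₀ ω k, (arrival ω k + y.1, y))) (by fun_prop)
    exact Measurable.mul (by fun_prop) (hV.comp (measurable_stock_sigma.comp hs))
  rw [G.lintegral_opportunityLaw hm]
  refine lintegral_congr fun s => ?_
  rw [expectedNext, mul_left_comm (ENNReal.ofReal _)]
  congr 1
  rw [Finset.mul_sum]
  refine Finset.sum_congr rfl fun i _ => ?_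
  rw [← G.lintegral_accept ((σ i).mem_Icc _ _ _), ← lintegral_const_mul' _ _ ENNReal.ofReal_ne_top]
  refine lintegral_congr fun m => ?_
  rw [← lintegral_const_mul' _ _ ENNReal.ofReal_ne_top]
  refine lintegral_congr fun z => ?_
  rw [stock_step]

/-- The expected discounted value of the flow payoff `f` of agent `i` at the opportunity following
the first `k` ones. -/
noncomputable def stageValue (f : ℝ → ℝ → ENNReal) (σ : Fin n → Strategy n) (i : Fin n) (x₀ : ℝ)
    (k : ℕ) : ENNReal :=
  ∫⁻ ω, discount ω (k + 1) * f (effortSeq σ i x₀ ω k) (stockSeq σ x₀ ω k) ∂G.P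

/-- The right-hand side of the Bellman equation for extended nonnegative flow payoffs `f` and
continuation values `V`. -/
noncomputable def bodyENN (f : ℝ → ℝ → ENNReal) (V : ℝ → ENNReal) (a x : ℝ) : ENNReal :=
  f a x + ENNReal.ofReal G.rate *
    (ENNReal.ofReal a * (∫⁻ z, V (x + z) ∂G.F) + ENNReal.ofReal (1 - a) * V x)

lemma natCast_inv_mul_sum_const (G : Game n) (c : ENNReal) : (n : ENNReal)⁻¹ * ∑ _i : Fin n, c = c := by
  have hn : (n : ENNReal) ≠ 0 := by
    have := G.two_le
    simp only [ne_eq, Nat.cast_eq_zero]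
    omega
  rw [Finset.sum_const, Finset.card_univ, Fintype.card_fin, nsmul_eq_mul, ← mul_assoc,
    ENNReal.inv_mul_cancel hn (ENNReal.natCast_ne_top n), one_mul]

lemma stage_eq {f : ℝ → ℝ → ENNReal} (hf : Measurable fun p : ℝ × ℝ => f p.1 p.2)
    {V : ℝ → ENNReal} (hV : Measurable V) (σ : Fin n → Strategy n) (x₀ : ℝ) (k : ℕ) :
    (n : ENNReal)⁻¹ * ∑ i, G.stageValue f σ i x₀ k +
        ENNReal.ofReal G.rate * ∫⁻ ω, discount ω (k + 1) * V (stockSeq σ x₀ ω (k + 1)) ∂G.P =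
      ∫⁻ ω, discount ω (k + 1) * ((n : ENNReal)⁻¹ *
        ∑ i, G.bodyENN f V (effortSeq σ i x₀ ω k) (stockSeq σ x₀ ω k)) ∂G.P := by
  have hd := measurable_discount (n := n) (k + 1)
  have hs := measurable_stockSeq σ x₀ k
  have hfi : ∀ i, Measurable fun ω => discount ω (k + 1) *
      f (effortSeq σ i x₀ ω k) (stockSeq σ x₀ ω k) := fun i =>
    hd.mul (hf.comp ((measurable_effortSeq σ i x₀ k).prodMk hs))
  rw [lintegral_discount_succ G σ x₀ k hV]
  simp_rw [stageValue]
  have hn : (n : ENNReal)⁻¹ ≠ ⊤ := by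
    have := G.two_le
    simp only [ne_eq, ENNReal.inv_eq_top, Nat.cast_eq_zero]
    omega
  rw [← lintegral_finsetSum _ fun i _ => hfi i, ← lintegral_const_mul' _ _ hn,
    ← lintegral_const_mul' _ _ ENNReal.ofReal_ne_top, ← lintegral_add_left
      ((Finset.measurable_sum _ fun i _ => hfi i).const_mul _)]
  refine lintegral_congr fun ω => ?_
  simp_rw [bodyENN, expectedNext, Finset.sum_add_distrib, ← Finset.mul_sum,
    Finset.sum_add_distrib]
  ring

/-- If `V` dominates the right-hand side of the Bellman equation, then the discounted value of `V`
along any path of play, together with the flow payoffs accumulated, is a supermartingale. -/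
theorem sum_stageValue_le {f : ℝ → ℝ → ENNReal} (hf : Measurable fun p : ℝ × ℝ => f p.1 p.2)
    {V : ℝ → ENNReal} (hV : Measurable V)
    (h : ∀ x, 0 ≤ x → ∀ a ∈ Icc (0 : ℝ) 1,
      G.bodyENN f V a x ≤ ENNReal.ofReal (1 + G.rate) * V x)
    (σ : Fin n → Strategy n) {x₀ : ℝ} (hx₀ : 0 ≤ x₀) (N : ℕ) :
    ∑ k ∈ Finset.range N, (n : ENNReal)⁻¹ * ∑ i, G.stageValue f σ i x₀ k +
        ENNReal.ofReal G.rate * ∫⁻ ω, discount ω N * V (stockSeq σ x₀ ω N) ∂G.P ≤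
      ENNReal.ofReal G.rate * V x₀ := by
  induction N with
  | zero => simp [discount, arrival, stockSeq_zero]
  | succ N ih =>
    refine le_trans ?_ ih
    rw [Finset.sum_range_succ, add_assoc]
    refine add_le_add le_rfl ?_
    rw [G.stage_eq hf hV, ← G.discount_succ_mul σ x₀ N hV,
      ← lintegral_const_mul' _ _ ENNReal.ofReal_ne_top]
    refine lintegral_mono_ae ?_
    filter_upwards [G.ae_forall_pos] with ω hω
    rw [mul_left_comm (ENNReal.ofReal (1 + G.rate))]
    refine mul_le_mul' le_rfl ?_
    refine le_trans ?_ (G.natCast_inv_mul_sum_const _).le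
    gcongr with i
    exact h _ (stockSeq_nonneg σ hx₀ hω N) _ (effortSeq_mem σ i x₀ ω N)

/-- If all agents follow a Markov strategy that attains equality in the Bellman equation, then the
supermartingale is a martingale. -/
theorem sum_stageValue_eq {f : ℝ → ℝ → ENNReal} (hf : Measurable fun p : ℝ × ℝ => f p.1 p.2)
    {V : ℝ → ENNReal} (hV : Measurable V) (α : MarkovStrategy)
    (h : ∀ x, 0 ≤ x → G.bodyENN f V (α.effort x) x = ENNReal.ofReal (1 + G.rate) * V x)
    {x₀ : ℝ} (hx₀ : 0 ≤ x₀) (N : ℕ) :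
    ∑ k ∈ Finset.range N, (n : ENNReal)⁻¹ *
          ∑ i, G.stageValue f (fun _ => α.toStrategy n) i x₀ k +
        ENNReal.ofReal G.rate *
          ∫⁻ ω, discount ω N * V (stockSeq (fun _ => α.toStrategy n) x₀ ω N) ∂G.P =
      ENNReal.ofReal G.rate * V x₀ := by
  induction N with
  | zero => simp [discount, arrival, stockSeq_zero]
  | succ N ih =>
    rw [← ih, Finset.sum_range_succ, add_assoc]
    congr 1
    rw [G.stage_eq hf hV, ← G.discount_succ_mul _ x₀ N hV,
      ← lintegral_const_mul' _ _ ENNReal.ofReal_ne_top]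
    refine lintegral_congr_ae ?_
    filter_upwards [G.ae_forall_pos] with ω hω
    rw [mul_left_comm (ENNReal.ofReal (1 + G.rate))]
    congr 1
    rw [← G.natCast_inv_mul_sum_const (ENNReal.ofReal (1 + G.rate) * _)]
    congr 1
    exact Finset.sum_congr rfl fun i _ => h _ (stockSeq_nonneg _ hx₀ hω N)

/-- A bound on the growth of `V` is enough for its discounted value to vanish along any path of
play. -/
lemma tendsto_lintegral_discount {V : ℝ → ENNReal} {C : ENNReal} (hC : C ≠ ⊤)
    (hV : ∀ x, 0 ≤ x → V x ≤ C * ENNReal.ofReal (1 + x))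
    (σ : Fin n → Strategy n) {x₀ : ℝ} (hx₀ : 0 ≤ x₀) :
    Tendsto (fun N => ∫⁻ ω, discount ω N * V (stockSeq σ x₀ ω N) ∂G.P) atTop (𝓝 0) := by
  have hr := G.rate_pos
  have hmu := mul_nonneg hr.le G.mu_nonneg
  -- the affine function `x + (1 + r μ)` dominates the flow `1 + x` in the Bellman equation
  have hbody : ∀ x, 0 ≤ x → ∀ a ∈ Icc (0 : ℝ) 1,
      G.bodyENN (fun _ x => ENNReal.ofReal (1 + x))
        (fun x => ENNReal.ofReal (x + (1 + G.rate * G.mu))) a x ≤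
      ENNReal.ofReal (1 + G.rate) * ENNReal.ofReal (x + (1 + G.rate * G.mu)) := by
    intro x hx a ha
    have e : ∫⁻ z, ENNReal.ofReal (x + z + (1 + G.rate * G.mu)) ∂G.F =
        ENNReal.ofReal (x + G.mu + (1 + G.rate * G.mu)) := by
      have hi₀ : Integrable (fun z => x + z) G.F := (integrable_const x).add G.F_mean
      have hi : Integrable (fun z => x + z + (1 + G.rate * G.mu)) G.F :=
        hi₀.add (integrable_const _)
      rw [← ofReal_integral_eq_lintegral_ofReal hi
        (by filter_upwards [G.ae_pos] with z hz; simp only [Pi.zero_apply]; linarith)]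
      congr 1
      rw [integral_add hi₀ (integrable_const _),
        integral_add (integrable_const x) G.F_mean]
      simp [mu]
    rw [bodyENN, e, ← ENNReal.ofReal_mul ha.1,
      ← ENNReal.ofReal_mul (by linarith [ha.2]), ← ENNReal.ofReal_add
        (mul_nonneg ha.1 (by linarith [G.mu_nonneg])) (mul_nonneg (by linarith [ha.2])
          (by linarith)), ← ENNReal.ofReal_mul hr.le, ← ENNReal.ofReal_mul (by linarith),
      ← ENNReal.ofReal_add (by linarith)]
    · refine ENNReal.ofReal_le_ofReal ?_
      have := mul_le_mul_of_nonneg_right ha.2 hmu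
      linarith
    · have h1 := mul_nonneg ha.1 G.mu_nonneg
      refine mul_nonneg hr.le ?_
      linarith
  have hfm : Measurable fun p : ℝ × ℝ => ENNReal.ofReal (1 + p.2) := by fun_prop
  have hle := fun N => (le_self_add).trans (G.sum_stageValue_le
    (f := fun _ x => ENNReal.ofReal (1 + x)) hfm
    (V := fun x => ENNReal.ofReal (x + (1 + G.rate * G.mu))) (by fun_prop) hbody σ hx₀ N)
  have hsum : ∑' k, (n : ENNReal)⁻¹ *
      ∑ i, G.stageValue (fun _ x => ENNReal.ofReal (1 + x)) σ i x₀ k ≠ ⊤ :=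
    ne_top_of_le_ne_top (ENNReal.mul_ne_top ENNReal.ofReal_ne_top ENNReal.ofReal_ne_top)
      (ENNReal.tsum_le_of_sum_range_le hle)
  have h0 := ENNReal.tendsto_atTop_zero_of_tsum_ne_top hsum
  simp only [stageValue, G.natCast_inv_mul_sum_const] at h0
  have h1 := ENNReal.Tendsto.const_mul (a := ENNReal.ofReal (1 + G.rate)) h0
    (Or.inr ENNReal.ofReal_ne_top)
  simp_rw [G.discount_succ_mul σ x₀ _ (V := fun x => ENNReal.ofReal (1 + x)) (by fun_prop)] at h1
  have h2 := ENNReal.Tendsto.const_mul (a := C * (ENNReal.ofReal G.rate)⁻¹) h1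
    (Or.inr (ENNReal.mul_ne_top hC (by simpa using hr)))
  rw [mul_zero, mul_zero] at h2
  refine tendsto_of_tendsto_of_tendsto_of_le_of_le tendsto_const_nhds h2 (fun _ => zero_le) ?_
  intro N
  simp only
  have hr0 : ENNReal.ofReal G.rate ≠ 0 := by simpa using hr
  rw [mul_assoc, ← mul_assoc (ENNReal.ofReal G.rate)⁻¹, ENNReal.inv_mul_cancel hr0
    ENNReal.ofReal_ne_top, one_mul, ← lintegral_const_mul' _ _ hC]
  refine lintegral_mono_ae ?_
  filter_upwards [G.ae_forall_pos] with ω hω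
  rw [mul_left_comm C]
  gcongr
  exact hV _ (stockSeq_nonneg σ hx₀ hω N)

end Game
end CollectiveInnovation

/-! ### Payoffs as sums over opportunities -/

namespace CollectiveInnovation

lemma tendsto_atTop_of_frequently_gap {s : ℕ → ℝ} (hs : Monotone s) {δ : ℝ} (hδ : 0 < δ)
    (h : ∃ᶠ k in atTop, δ ≤ s (k + 1) - s k) : Tendsto s atTop atTop := by
  rcases tendsto_atTop_of_monotone hs with h1 | ⟨l, hl⟩
  · exact h1
  · have h2 : Tendsto (fun k => s (k + 1) - s k) atTop (𝓝 (l - l)) :=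
      (hl.comp (tendsto_add_atTop_nat 1)).sub hl
    rw [sub_self] at h2
    obtain ⟨k, hk1, hk2⟩ := (h.and_eventually (h2.eventually_lt_const hδ)).exists
    exact absurd hk2 (not_lt.2 hk1)

variable {n : ℕ}

lemma strictMono_arrival {ω : Sample n} (hω : ∀ j, 0 < (ω j).1 ∧ 0 < (ω j).2.2.2) :
    StrictMono (arrival ω) :=
  strictMono_nat_of_lt_succ fun k => by rw [arrival_succ]; linarith [(hω k).1]

lemma arrival_nonneg {ω : Sample n} (hω : ∀ j, 0 < (ω j).1 ∧ 0 < (ω j).2.2.2) (k : ℕ) :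
    0 ≤ arrival ω k := by
  have := (strictMono_arrival hω).monotone (Nat.zero_le k)
  simpa [arrival] using this

lemma count_eq {ω : Sample n} (hω : ∀ j, 0 < (ω j).1 ∧ 0 < (ω j).2.2.2) {k : ℕ} {t : ℝ}
    (ht : t ∈ Ico (arrival ω k) (arrival ω (k + 1))) : count ω t = k := by
  have hm := strictMono_arrival hω
  have e : {j : ℕ | arrival ω j ≤ t} = Iic k := by
    ext j
    refine ⟨fun hj => ?_, fun hj => (hm.monotone hj).trans ht.1⟩
    have : j < k + 1 := hm.lt_iff_lt.1 (lt_of_le_of_lt hj ht.2)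
    exact Nat.lt_succ_iff.1 this
  rw [count, e, csSup_Iic]

lemma exists_mem_Ico_arrival {ω : Sample n} (hlim : Tendsto (arrival ω) atTop atTop) {t : ℝ} (ht : 0 ≤ t) :
    ∃ k, t ∈ Ico (arrival ω k) (arrival ω (k + 1)) := by
  classical
  have hex : ∃ j, t < arrival ω j := (hlim.eventually_gt_atTop t).exists
  obtain ⟨k, hk⟩ : ∃ k, Nat.find hex = k + 1 := by
    refine Nat.exists_eq_succ_of_ne_zero fun h0 => ?_
    have := Nat.find_spec hex
    rw [h0] at this
    simp only [arrival, Finset.range_zero, Finset.sum_empty] at this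
    linarith
  refine ⟨k, not_lt.1 (Nat.find_min hex (by omega)), ?_⟩
  rw [← hk]
  exact Nat.find_spec hex

/-- A function of the current history and time splits into its restrictions to the periods between
consecutive opportunities. -/
lemma historyAt_eq_tsum (σ : Fin n → Strategy n) (x₀ : ℝ) {ω : Sample n}
    (hω : ∀ j, 0 < (ω j).1 ∧ 0 < (ω j).2.2.2) (hlim : Tendsto (arrival ω) atTop atTop)
    (φ : (Σ m, History n m) × ℝ → ENNReal) {t : ℝ} (ht : 0 ≤ t) :
    φ (historyAt σ x₀ ω t, t) = ∑' k, (Ico (arrival ω k) (arrival ω (k + 1))).indicator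
      (fun t => φ (reached σ x₀ ω k, t)) t := by
  obtain ⟨k, hk⟩ := exists_mem_Ico_arrival hlim ht
  rw [tsum_eq_single k, indicator_of_mem hk, historyAt, count_eq hω hk]
  intro j hj
  exact indicator_of_notMem (fun h => hj ((count_eq hω h).symm.trans (count_eq hω hk))) _

lemma tendsto_count {ω : Sample n} (hω : ∀ j, 0 < (ω j).1 ∧ 0 < (ω j).2.2.2)
    (hlim : Tendsto (arrival ω) atTop atTop) : Tendsto (count ω) atTop atTop := by
  refine tendsto_atTop.2 fun k => ?_
  filter_upwards [eventually_ge_atTop (arrival ω k)] with t ht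
  obtain ⟨j, hj⟩ := exists_mem_Ico_arrival hlim ((arrival_nonneg hω k).trans ht)
  rw [count_eq hω hj]
  exact Nat.lt_succ_iff.1 ((strictMono_arrival hω).lt_iff_lt.1 (lt_of_le_of_lt ht hj.2))

namespace Game

variable (G : Game n)

lemma ae_tendsto_arrival : ∀ᵐ ω ∂G.P, Tendsto (arrival ω) atTop atTop := by
  have := G.isProbabilityMeasure_waiting
  have : Nonempty (Fin n) := ⟨⟨0, lt_of_lt_of_le (by norm_num) G.two_le⟩⟩
  have hA : MeasurableSet (Ioi (1 : ℝ) ×ˢ (univ : Set (Fin n × unitInterval × ℝ))) :=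
    measurableSet_Ioi.prod MeasurableSet.univ
  have hpos : G.opportunityLaw (Ioi (1 : ℝ) ×ˢ (univ : Set (Fin n × unitInterval × ℝ))) ≠ 0 := by
    rw [opportunityLaw, Measure.prod_prod, measure_univ, mul_one]
    have := expMeasure_Ioi G.rate_pos zero_le_one
    rw [rate] at this
    rw [this]
    exact (ENNReal.ofReal_pos.2 (Real.exp_pos _)).ne'
  filter_upwards [G.ae_forall_pos, G.ae_frequently_mem hA hpos] with ω hω hfr
  refine tendsto_atTop_of_frequently_gap (strictMono_arrival hω).monotone one_pos
    (hfr.mono fun k hk => ?_)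
  rw [arrival_succ, add_sub_cancel_left]
  exact (mem_prod.1 hk).1.le

/-- The expected integral over the period between the `k`-th opportunity and the next one is the
expected value at the next one, up to the factor `G.rate`. -/
lemma lintegral_period (σ : Fin n → Strategy n) (x₀ : ℝ) (k : ℕ)
    {φ : (Σ m, History n m) × ℝ → ENNReal} (hφ : Measurable φ) :
    Measurable (fun p : Sample n × ℝ => (Ico (arrival p.1 k) (arrival p.1 (k + 1))).indicator
      (fun t => φ (reached σ x₀ p.1 k, t)) p.2) ∧
    ENNReal.ofReal G.rate * ∫⁻ p : Sample n × ℝ,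
        (Ico (arrival p.1 k) (arrival p.1 (k + 1))).indicator
          (fun t => φ (reached σ x₀ p.1 k, t)) p.2 ∂(G.P.prod (volume.restrict (Ioi (0 : ℝ)))) =
      ∫⁻ ω, φ (reached σ x₀ ω k, arrival ω (k + 1)) ∂G.P := by
  have hm : Measurable (fun p : Sample n × ℝ =>
      (Ico (arrival p.1 k) (arrival p.1 (k + 1))).indicator
        (fun t => φ (reached σ x₀ p.1 k, t)) p.2) := by
    have e : (fun p : Sample n × ℝ => (Ico (arrival p.1 k) (arrival p.1 (k + 1))).indicator
          (fun t => φ (reached σ x₀ p.1 k, t)) p.2) =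
        {p : Sample n × ℝ | arrival p.1 k ≤ p.2 ∧ p.2 < arrival p.1 (k + 1)}.indicator
          (fun p => φ (reached σ x₀ p.1 k, p.2)) := by
      ext p
      simp [indicator_apply]
    rw [e]
    have h1 : Measurable fun p : Sample n × ℝ => arrival p.1 k :=
      (measurable_arrival k).comp measurable_fst
    have h2 : Measurable fun p : Sample n × ℝ => arrival p.1 (k + 1) :=
      (measurable_arrival (k + 1)).comp measurable_fst
    exact (hφ.comp (((measurable_reached σ x₀ k).comp measurable_fst).prodMk
      measurable_snd)).indicator
      ((measurableSet_le h1 measurable_snd).inter (measurableSet_lt measurable_snd h2))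
  refine ⟨hm, ?_⟩
  rw [lintegral_prod _ hm.aemeasurable, G.lintegral_update k hm.lintegral_prod_right',
    G.lintegral_next_arrival σ x₀ k hφ, ← lintegral_const_mul' _ _ ENNReal.ofReal_ne_top]
  refine lintegral_congr_ae ?_
  filter_upwards [G.ae_forall_pos] with ω hω
  simp_rw [arrival_update ω k _ le_rfl, arrival_update_succ, reached_update σ x₀ ω k _ le_rfl]
  have hg : Measurable fun t => φ (reached σ x₀ ω k, t) := by fun_prop
  have hs : Measurable fun s : ℝ => ∫⁻ t in Ioi (0 : ℝ),
      (Ico (arrival ω k) (arrival ω k + s)).indicator (fun t => φ (reached σ x₀ ω k, t)) t := by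
    refine Measurable.lintegral_prod_right' (f := fun p : ℝ × ℝ =>
      (Ico (arrival ω k) (arrival ω k + p.1)).indicator
        (fun t => φ (reached σ x₀ ω k, t)) p.2) ?_
    have e : (fun p : ℝ × ℝ => (Ico (arrival ω k) (arrival ω k + p.1)).indicator
          (fun t => φ (reached σ x₀ ω k, t)) p.2) =
        {p : ℝ × ℝ | arrival ω k ≤ p.2 ∧ p.2 < arrival ω k + p.1}.indicator
          (fun p => φ (reached σ x₀ ω k, p.2)) := by
      ext p
      simp [indicator_apply]
    rw [e]
    have h1 : MeasurableSet {p : ℝ × ℝ | arrival ω k ≤ p.2} :=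
      measurableSet_le (by fun_prop) (by fun_prop)
    have h2 : MeasurableSet {p : ℝ × ℝ | p.2 < arrival ω k + p.1} :=
      measurableSet_lt (by fun_prop) (by fun_prop)
    exact (hg.comp measurable_snd).indicator (h1.inter h2)
  rw [G.lintegral_opportunityLaw_fst hs]
  exact lintegral_until_arrival G.rate_pos (arrival_nonneg hω k) hg

lemma ae_prod_regular : ∀ᵐ p ∂(G.P.prod (volume.restrict (Ioi (0 : ℝ)))),
    (∀ j, 0 < (p.1 j).1 ∧ 0 < (p.1 j).2.2.2) ∧ Tendsto (arrival p.1) atTop atTop ∧ 0 < p.2 := by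
  have h1 := Measure.quasiMeasurePreserving_fst (μ := G.P)
    (ν := volume.restrict (Ioi (0 : ℝ))) |>.ae G.ae_forall_pos
  have h2 := Measure.quasiMeasurePreserving_fst (μ := G.P)
    (ν := volume.restrict (Ioi (0 : ℝ))) |>.ae G.ae_tendsto_arrival
  have h3 := Measure.quasiMeasurePreserving_snd (μ := G.P)
    (ν := volume.restrict (Ioi (0 : ℝ))) |>.ae (ae_restrict_mem measurableSet_Ioi)
  filter_upwards [h1, h2, h3] with p hp1 hp2 hp3 using ⟨hp1, hp2, hp3⟩

/-- The expected integral over time of a function of the current history and time is, up to the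
factor `G.rate`, the expected sum of its values at the opportunities. -/
lemma lintegral_historyAt (σ : Fin n → Strategy n) (x₀ : ℝ)
    {φ : (Σ m, History n m) × ℝ → ENNReal} (hφ : Measurable φ) :
    AEMeasurable (fun p : Sample n × ℝ => φ (historyAt σ x₀ p.1 p.2, p.2))
      (G.P.prod (volume.restrict (Ioi (0 : ℝ)))) ∧
    ENNReal.ofReal G.rate * ∫⁻ p : Sample n × ℝ, φ (historyAt σ x₀ p.1 p.2, p.2)
        ∂(G.P.prod (volume.restrict (Ioi (0 : ℝ)))) =
      ∑' k, ∫⁻ ω, φ (reached σ x₀ ω k, arrival ω (k + 1)) ∂G.P := by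
  have hm := fun k => (G.lintegral_period σ x₀ k hφ).1
  have hae : (fun p : Sample n × ℝ => φ (historyAt σ x₀ p.1 p.2, p.2))
      =ᵐ[G.P.prod (volume.restrict (Ioi (0 : ℝ)))] fun p =>
        ∑' k, (Ico (arrival p.1 k) (arrival p.1 (k + 1))).indicator
          (fun t => φ (reached σ x₀ p.1 k, t)) p.2 := by
    filter_upwards [G.ae_prod_regular] with p hp
    exact historyAt_eq_tsum σ x₀ hp.1 hp.2.1 φ hp.2.2.le
  refine ⟨(Measurable.tsum hm).aemeasurable.congr hae.symm, ?_⟩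
  rw [lintegral_congr_ae hae, lintegral_tsum fun k => (hm k).aemeasurable, ← ENNReal.tsum_mul_left]
  exact tsum_congr fun k => (G.lintegral_period σ x₀ k hφ).2

/-- The flow payoff, normalised to be nonnegative by subtracting its minimum `u(1,0)` and extended
to all real efforts and stocks. -/
noncomputable def shiftedFlow (a x : ℝ) : ENNReal :=
  ENNReal.ofReal (G.u (projIcc 0 1 zero_le_one a : ℝ) (max x 0) - G.u 1 0)

lemma shiftedFlow_eq {a x : ℝ} (ha : a ∈ Icc (0 : ℝ) 1) (hx : 0 ≤ x) :
    G.shiftedFlow a x = ENNReal.ofReal (G.u a x - G.u 1 0) := by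
  rw [shiftedFlow, projIcc_of_mem _ ha, max_eq_left hx]

namespace StandingAssumptions

variable {G} (hG : G.StandingAssumptions)
include hG

lemma u_ge {a x : ℝ} (ha : a ∈ Icc (0 : ℝ) 1) (hx : 0 ≤ x) : G.u 1 0 ≤ G.u a x := by
  have h1 := hG.c_mono 0 le_rfl ha (right_mem_Icc.2 zero_le_one) ha.2
  have h2 := hG.u_mono a ha self_mem_Ici hx hx
  simp only [c] at h1 h2
  linarith

lemma measurable_shiftedFlow : Measurable fun p : ℝ × ℝ => G.shiftedFlow p.1 p.2 := by
  have hproj : Continuous fun p : ℝ × ℝ =>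
      ((projIcc (0 : ℝ) 1 zero_le_one p.1 : ℝ), max p.2 0) :=
    (continuous_subtype_val.comp ((continuous_projIcc (h := zero_le_one)).comp
      continuous_fst)).prodMk (continuous_snd.max continuous_const)
  have h : Continuous fun p : ℝ × ℝ => G.u (projIcc 0 1 zero_le_one p.1 : ℝ) (max p.2 0) :=
    hG.smooth.continuousOn.comp_continuous hproj
      fun p => ⟨(projIcc 0 1 zero_le_one p.1).2, mem_Ici.2 (le_max_right p.2 0)⟩
  exact (h.measurable.sub_const _).ennreal_ofReal

/-- If the normalised payoff of an agent is finite, then the discounted flow payoff is integrable,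
and the payoff is a sum over opportunities. -/
theorem payoff_eq (σ : Fin n → Strategy n) (i : Fin n) {x₀ : ℝ} (hx₀ : 0 ≤ x₀)
    (hfin : ∑' k, G.stageValue G.shiftedFlow σ i x₀ k ≠ ⊤) :
    Integrable (fun p : Sample n × ℝ => G.discountedFlow σ i x₀ p.1 p.2)
      (G.P.prod (volume.restrict (Ioi (0 : ℝ)))) ∧
    G.payoff σ i x₀ = ((ENNReal.ofReal G.rate)⁻¹ *
      ∑' k, G.stageValue G.shiftedFlow σ i x₀ k).toReal + G.u 1 0 := by
  have hr0 : ENNReal.ofReal G.rate ≠ 0 := by simpa using G.rate_pos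
  set φ : (Σ m, History n m) × ℝ → ENNReal := fun p =>
    ENNReal.ofReal (Real.exp (-p.2)) * G.shiftedFlow ((σ i).effort _ p.1.2 p.2) p.1.2.stock with hφd
  have hφ : Measurable φ := by
    have h1 : Measurable fun p : (Σ m, History n m) × ℝ =>
      ENNReal.ofReal (Real.exp (-p.2)) := by fun_prop
    refine h1.mul ?_
    exact hG.measurable_shiftedFlow.comp ((σ i).measurable_effort.prodMk
      (measurable_stock_sigma.comp measurable_fst))
  obtain ⟨hmeas, hint⟩ := G.lintegral_historyAt σ x₀ hφ
  change _ = ∑' k, G.stageValue G.shiftedFlow σ i x₀ k at hint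
  have hint' : ∫⁻ p : Sample n × ℝ, φ (historyAt σ x₀ p.1 p.2, p.2)
      ∂(G.P.prod (volume.restrict (Ioi (0 : ℝ)))) =
        (ENNReal.ofReal G.rate)⁻¹ * ∑' k, G.stageValue G.shiftedFlow σ i x₀ k := by
    rw [← hint, ← mul_assoc, ENNReal.inv_mul_cancel hr0 ENNReal.ofReal_ne_top, one_mul]
  have hne : ∫⁻ p : Sample n × ℝ, φ (historyAt σ x₀ p.1 p.2, p.2)
      ∂(G.P.prod (volume.restrict (Ioi (0 : ℝ)))) ≠ ⊤ := by
    rw [hint']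
    exact ENNReal.mul_ne_top (ENNReal.inv_ne_top.2 hr0) hfin
  have hae : (fun p : Sample n × ℝ => G.discountedFlow σ i x₀ p.1 p.2)
      =ᵐ[G.P.prod (volume.restrict (Ioi (0 : ℝ)))] fun p =>
        (φ (historyAt σ x₀ p.1 p.2, p.2)).toReal + Real.exp (-p.2) * G.u 1 0 := by
    filter_upwards [G.ae_prod_regular] with p hp
    have hx : 0 ≤ stockAt σ x₀ p.1 p.2 := stockSeq_nonneg σ hx₀ hp.1 (count p.1 p.2)
    have ha : effortAt σ i x₀ p.1 p.2 ∈ Icc (0 : ℝ) 1 := (σ i).mem_Icc _ _ _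
    have e : φ (historyAt σ x₀ p.1 p.2, p.2) = ENNReal.ofReal (Real.exp (-p.2)) *
        G.shiftedFlow (effortAt σ i x₀ p.1 p.2) (stockAt σ x₀ p.1 p.2) := rfl
    rw [e, G.shiftedFlow_eq ha hx, ENNReal.toReal_mul, ENNReal.toReal_ofReal (Real.exp_pos _).le,
      ENNReal.toReal_ofReal (sub_nonneg.2 (hG.u_ge ha hx)), discountedFlow, ← u_eq]
    ring
  have hi1 : Integrable (fun p : Sample n × ℝ => (φ (historyAt σ x₀ p.1 p.2, p.2)).toReal)
      (G.P.prod (volume.restrict (Ioi (0 : ℝ)))) :=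
    integrable_toReal_of_lintegral_ne_top hmeas hne
  have hi2 : Integrable (fun p : Sample n × ℝ => Real.exp (-p.2) * G.u 1 0)
      (G.P.prod (volume.restrict (Ioi (0 : ℝ)))) := by
    have h : Integrable (fun t => Real.exp (-t) * G.u 1 0) (volume.restrict (Ioi (0 : ℝ))) :=
      (integrableOn_exp_neg_Ioi 0).mul_const _
    exact h.comp_snd G.P
  have hi := (hi1.add hi2).congr hae.symm
  refine ⟨hi, ?_⟩
  have h2 : ∫ p : Sample n × ℝ, Real.exp (-p.2) * G.u 1 0
      ∂(G.P.prod (volume.restrict (Ioi (0 : ℝ)))) = G.u 1 0 := by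
    rw [integral_prod _ hi2]
    simp only [integral_mul_const, integral_exp_neg_Ioi_zero, one_mul, integral_const,
      probReal_univ, one_smul]
  rw [payoff, ← integral_prod _ hi, integral_congr_ae hae, integral_add hi1 hi2, h2,
    integral_toReal hmeas (ae_lt_top' hmeas hne), hint']

end StandingAssumptions
end Game
end CollectiveInnovation

/-! ### Verification -/

namespace CollectiveInnovation
namespace Game

variable {n : ℕ} (G : Game n)

/-- The value function `v`, normalised like the flow payoff. -/
noncomputable def shiftedValue (v : ℝ → ℝ) (x : ℝ) : ENNReal := ENNReal.ofReal (v x - G.u 1 0)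

lemma mul_shiftedValue (v : ℝ → ℝ) (x : ℝ) :
    ENNReal.ofReal (1 + G.rate) * G.shiftedValue v x =
      ENNReal.ofReal ((1 + G.rate) * v x - (1 + G.rate) * G.u 1 0) := by
  rw [shiftedValue, ← ENNReal.ofReal_mul (by linarith [G.rate_pos]), mul_sub]

lemma IsCandidate.measurable_shiftedValue {G : Game n} {v : ℝ → ℝ} (hv : G.IsCandidate v) :
    Measurable (G.shiftedValue v) :=
  (hv.mono.measurable.sub_const _).ennreal_ofReal

lemma tsum_average_stageValue (f : ℝ → ℝ → ENNReal) (σ : Fin n → Strategy n) (x₀ : ℝ) :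
    ∑' k, (n : ENNReal)⁻¹ * ∑ i, G.stageValue f σ i x₀ k =
      (n : ENNReal)⁻¹ * ∑ i, ∑' k, G.stageValue f σ i x₀ k := by
  rw [ENNReal.tsum_mul_left, Summable.tsum_finsetSum fun i _ => ENNReal.summable]

namespace StandingAssumptions

variable {G} (hG : G.StandingAssumptions)
include hG

lemma value_ge {v : ℝ → ℝ} (hv : G.IsCandidate v) {x : ℝ} (hx : 0 ≤ x) : G.u 1 0 ≤ v x :=
  (hG.u_ge (left_mem_Icc.2 zero_le_one) hx).trans (hv.lower x hx)

lemma bodyENN_eq {v : ℝ → ℝ} (hv : G.IsCandidate v) {a x : ℝ} (ha : a ∈ Icc (0 : ℝ) 1)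
    (hx : 0 ≤ x) : G.bodyENN G.shiftedFlow (G.shiftedValue v) a x =
      ENNReal.ofReal (G.bellmanBody v a x - (1 + G.rate) * G.u 1 0) := by
  have hr := G.rate_pos
  have hint := hG.integrable_value hv hx
  have hae : 0 ≤ᵐ[G.F] fun z => v (x + z) - G.u 1 0 := by
    filter_upwards [G.ae_pos] with z hz
    exact sub_nonneg.2 (hG.value_ge hv (by linarith))
  have e : ∫⁻ z, G.shiftedValue v (x + z) ∂G.F =
      ENNReal.ofReal ((∫ z, v (x + z) ∂G.F) - G.u 1 0) := by
    have hi : Integrable (fun z => v (x + z) - G.u 1 0) G.F := hint.sub (integrable_const _)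
    simp only [shiftedValue]
    rw [← ofReal_integral_eq_lintegral_ofReal hi hae,
      integral_sub hint (integrable_const _)]
    simp
  have h1 : 0 ≤ (∫ z, v (x + z) ∂G.F) - G.u 1 0 := by
    have := integral_nonneg_of_ae hae
    rw [integral_sub hint (integrable_const _)] at this
    simpa using this
  have h2 : 0 ≤ v x - G.u 1 0 := sub_nonneg.2 (hG.value_ge hv hx)
  have h3 : 0 ≤ G.u a x - G.u 1 0 := sub_nonneg.2 (hG.u_ge ha hx)
  have h4 := mul_nonneg ha.1 h1
  have h5 := mul_nonneg (sub_nonneg.2 ha.2) h2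
  rw [bodyENN, e, G.shiftedFlow_eq ha hx, shiftedValue, ← ENNReal.ofReal_mul ha.1,
    ← ENNReal.ofReal_mul (sub_nonneg.2 ha.2), ← ENNReal.ofReal_add h4 h5,
    ← ENNReal.ofReal_mul hr.le, ← ENNReal.ofReal_add h3 (mul_nonneg hr.le (add_nonneg h4 h5))]
  congr 1
  rw [bellmanBody]
  ring

/-- The Bellman inequality holds at the effort of each agent, hence for the average across agents:
no profile generates more welfare than `v`. -/
lemma tsum_average_le {v : ℝ → ℝ} (hv : G.IsSolution v) (σ : Fin n → Strategy n) {x₀ : ℝ}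
    (hx₀ : 0 ≤ x₀) : ∑' k, (n : ENNReal)⁻¹ * ∑ i, G.stageValue G.shiftedFlow σ i x₀ k ≤
      ENNReal.ofReal G.rate * G.shiftedValue v x₀ := by
  refine ENNReal.tsum_le_of_sum_range_le fun N => le_self_add.trans
    (G.sum_stageValue_le hG.measurable_shiftedFlow hv.measurable_shiftedValue
      (fun x hx a ha => ?_) σ hx₀ N)
  rw [hG.bodyENN_eq hv.toIsCandidate ha hx, G.mul_shiftedValue]
  exact ENNReal.ofReal_le_ofReal (sub_le_sub_right (hv.body_le x hx a ha) _)

lemma tsum_stageValue_ne_top {v : ℝ → ℝ} (hv : G.IsSolution v) (σ : Fin n → Strategy n)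
    (i : Fin n) {x₀ : ℝ} (hx₀ : 0 ≤ x₀) :
    ∑' k, G.stageValue G.shiftedFlow σ i x₀ k ≠ ⊤ := by
  have h := hG.tsum_average_le hv σ hx₀
  rw [G.tsum_average_stageValue] at h
  have h1 : (n : ENNReal)⁻¹ * ∑ i, ∑' k, G.stageValue G.shiftedFlow σ i x₀ k ≠ ⊤ :=
    ne_top_of_le_ne_top (ENNReal.mul_ne_top ENNReal.ofReal_ne_top ENNReal.ofReal_ne_top) h
  intro htop
  have h2 : ∑ i, ∑' k, G.stageValue G.shiftedFlow σ i x₀ k = ⊤ :=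
    ENNReal.sum_eq_top.2 ⟨i, Finset.mem_univ i, htop⟩
  rw [h2, ENNReal.mul_top (ENNReal.inv_ne_zero.2 (ENNReal.natCast_ne_top n))] at h1
  exact h1 rfl

lemma welfare_eq {v : ℝ → ℝ} (hv : G.IsSolution v) (σ : Fin n → Strategy n) {x₀ : ℝ}
    (hx₀ : 0 ≤ x₀) : G.welfare σ x₀ = ((ENNReal.ofReal G.rate)⁻¹ *
      ∑' k, (n : ENNReal)⁻¹ * ∑ i, G.stageValue G.shiftedFlow σ i x₀ k).toReal + G.u 1 0 := by
  have hn : (n : ℝ) ≠ 0 := by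
    have := G.two_le
    simp only [ne_eq, Nat.cast_eq_zero]
    omega
  have hfin := fun i => hG.tsum_stageValue_ne_top hv σ i hx₀
  have hpay : ∀ i, G.payoff σ i x₀ = _ := fun i => (hG.payoff_eq σ i hx₀ (hfin i)).2
  rw [welfare, G.tsum_average_stageValue]
  simp only [hpay, ENNReal.toReal_mul, Finset.sum_add_distrib, Finset.sum_const, Finset.card_univ,
    Fintype.card_fin, nsmul_eq_mul, ENNReal.toReal_inv, ENNReal.toReal_natCast,
    ENNReal.toReal_sum fun i _ => hfin i, ← Finset.mul_sum]
  field_simp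

lemma welfare_le {v : ℝ → ℝ} (hv : G.IsSolution v) (σ : Fin n → Strategy n) {x₀ : ℝ}
    (hx₀ : 0 ≤ x₀) : G.welfare σ x₀ ≤ v x₀ := by
  have hr0 : ENNReal.ofReal G.rate ≠ 0 := by simpa using G.rate_pos
  have h : (ENNReal.ofReal G.rate)⁻¹ *
      ∑' k, (n : ENNReal)⁻¹ * ∑ i, G.stageValue G.shiftedFlow σ i x₀ k ≤ G.shiftedValue v x₀ := by
    refine (mul_le_mul' le_rfl (hG.tsum_average_le hv σ hx₀)).trans_eq ?_
    rw [← mul_assoc, ENNReal.inv_mul_cancel hr0 ENNReal.ofReal_ne_top, one_mul]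
  have h1 := ENNReal.toReal_mono ENNReal.ofReal_ne_top h
  rw [ENNReal.toReal_ofReal (sub_nonneg.2 (hG.value_ge hv.toIsCandidate hx₀))] at h1
  rw [hG.welfare_eq hv σ hx₀]
  linarith

lemma exists_shiftedValue_growth {v : ℝ → ℝ} (hv : G.IsCandidate v) :
    ∃ C : ENNReal, C ≠ ⊤ ∧ ∀ x, 0 ≤ x → G.shiftedValue v x ≤ C * ENNReal.ofReal (1 + x) := by
  set K := |G.b 0 + G.rate * (G.mu * G.bDeriv 0) - G.u 1 0|
  have hK : 0 ≤ K := abs_nonneg _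
  have hb := hG.bDeriv_nonneg le_rfl
  refine ⟨ENNReal.ofReal (K + G.bDeriv 0), ENNReal.ofReal_ne_top, fun x hx => ?_⟩
  rw [shiftedValue, ← ENNReal.ofReal_mul (by linarith)]
  refine ENNReal.ofReal_le_ofReal ?_
  have h1 := hv.upper x hx
  have h2 : G.b x ≤ G.b 0 + G.bDeriv 0 * x := by
    rcases hx.eq_or_lt with rfl | hx'
    · simp
    · simpa using hG.b_add_le le_rfl hx'
  have h3 : G.b 0 + G.rate * (G.mu * G.bDeriv 0) - G.u 1 0 ≤ K := le_abs_self _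
  have h4 := mul_nonneg hK hx
  linarith

lemma welfare_optimal {v : ℝ → ℝ} (hv : G.IsSolution v) (α : MarkovStrategy)
    (hα : α.effort = G.optimalEffort v) {x₀ : ℝ} (hx₀ : 0 ≤ x₀) :
    G.welfare (fun _ => α.toStrategy n) x₀ = v x₀ := by
  have hr0 : ENNReal.ofReal G.rate ≠ 0 := by simpa using G.rate_pos
  obtain ⟨C, hC, hgrowth⟩ := hG.exists_shiftedValue_growth hv.toIsCandidate
  have hsum := fun N => G.sum_stageValue_eq hG.measurable_shiftedFlow
    hv.measurable_shiftedValue α (fun x hx => by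
      rw [hα, hG.bodyENN_eq hv.toIsCandidate (hG.optimalEffort_mem v x) hx, G.mul_shiftedValue,
        hG.bellmanBody_optimalEffort hv hx]) hx₀ N
  have hlim := ENNReal.Tendsto.const_mul (a := ENNReal.ofReal G.rate)
    (G.tendsto_lintegral_discount hC hgrowth (fun _ => α.toStrategy n) hx₀)
    (Or.inr ENNReal.ofReal_ne_top)
  have htot : ∑' k, (n : ENNReal)⁻¹ *
      ∑ i, G.stageValue G.shiftedFlow (fun _ => α.toStrategy n) i x₀ k =
        ENNReal.ofReal G.rate * G.shiftedValue v x₀ := by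
    have h1 := (ENNReal.tendsto_nat_tsum fun k => (n : ENNReal)⁻¹ *
      ∑ i, G.stageValue G.shiftedFlow (fun _ => α.toStrategy n) i x₀ k).add hlim
    simp_rw [hsum, mul_zero, add_zero] at h1
    exact tendsto_nhds_unique h1 tendsto_const_nhds
  rw [hG.welfare_eq hv _ hx₀, htot, ← mul_assoc, ENNReal.inv_mul_cancel hr0 ENNReal.ofReal_ne_top,
    one_mul, shiftedValue,
    ENNReal.toReal_ofReal (sub_nonneg.2 (hG.value_ge hv.toIsCandidate hx₀))]
  ring

end StandingAssumptions

lemma exists_F_Ici_ne_zero : ∃ δ : ℝ, 0 < δ ∧ G.F (Ici δ) ≠ 0 := by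
  by_contra! h
  have h1 : ∀ᵐ z ∂G.F, ∀ m : ℕ, z < 1 / ((m : ℝ) + 1) := by
    refine ae_all_iff.2 fun m => ?_
    rw [ae_iff]
    simpa [Ici] using h (1 / ((m : ℝ) + 1)) Nat.one_div_pos_of_nat
  obtain ⟨z, hz, hz'⟩ := (G.ae_pos.and h1).exists
  obtain ⟨m, hm⟩ := exists_nat_one_div_lt hz
  exact lt_asymm hm (hz' m)

/-- If all agents play a decreasing Markov strategy that vanishes at large stocks, then effort
vanishes along almost every path: were it bounded away from zero, then infinitely many increments of
a given size would occur, and the stock would grow without bound. -/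
theorem ae_tendsto_effort (α : MarkovStrategy) (hanti : Antitone α.effort)
    (hlim : Tendsto α.effort atTop (𝓝 0)) (x₀ : ℝ) :
    ∀ᵐ ω ∂G.P, Tendsto
      (fun t : ℝ => α.effort (stockAt (fun _ => α.toStrategy n) x₀ ω t)) atTop (𝓝 0) := by
  have := G.isProbabilityMeasure_waiting
  have : Nonempty (Fin n) := ⟨⟨0, lt_of_lt_of_le (by norm_num) G.two_le⟩⟩
  obtain ⟨δ, hδ, hFδ⟩ := G.exists_F_Ici_ne_zero
  have hfreq : ∀ᵐ ω ∂G.P, ∀ m : ℕ, ∃ᶠ j in atTop,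
      ((ω j).2.2.1 : ℝ) ≤ 1 / ((m : ℝ) + 1) ∧ δ ≤ (ω j).2.2.2 := by
    refine ae_all_iff.2 fun m => ?_
    have hm : 1 / ((m : ℝ) + 1) ∈ Icc (0 : ℝ) 1 :=
      ⟨by positivity, (div_le_one (by positivity)).2 (by linarith [m.cast_nonneg (α := ℝ)])⟩
    have hA : MeasurableSet ((univ : Set ℝ) ×ˢ (univ : Set (Fin n)) ×ˢ
        Iic (⟨_, hm⟩ : unitInterval) ×ˢ Ici δ) :=
      MeasurableSet.univ.prod (MeasurableSet.univ.prod (measurableSet_Iic.prod measurableSet_Ici))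
    filter_upwards [G.ae_frequently_mem hA (by
      rw [opportunityLaw, Measure.prod_prod, Measure.prod_prod, Measure.prod_prod]
      simp only [measure_univ, one_mul, unitInterval.volume_Iic]
      exact mul_ne_zero (ENNReal.ofReal_pos.2 Nat.one_div_pos_of_nat).ne' hFδ)] with ω hω
    exact hω.mono fun j hj => ⟨hj.2.2.1, hj.2.2.2⟩
  filter_upwards [G.ae_forall_pos, G.ae_tendsto_arrival, hfreq] with ω hω harr hfr
  set s := stockSeq (fun _ => α.toStrategy n) x₀ ω with hs
  have hmono : Monotone s := monotone_stockSeq _ x₀ hω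
  have hseq : Tendsto (fun k => α.effort (s k)) atTop (𝓝 0) := by
    refine tendsto_order.2 ⟨fun b hb => Eventually.of_forall fun k =>
      hb.trans_le (α.mem_Icc _).1, fun b hb => ?_⟩
    suffices h : ∃ k, α.effort (s k) < b by
      obtain ⟨k, hk⟩ := h
      filter_upwards [eventually_ge_atTop k] with j hj using (hanti (hmono hj)).trans_lt hk
    by_contra! hge
    obtain ⟨m, hm⟩ := exists_nat_one_div_lt hb
    have hgap : Tendsto s atTop atTop := by
      refine tendsto_atTop_of_frequently_gap hmono hδ ((hfr m).mono fun k hk => ?_)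
      have hacc : ((ω k).2.2.1 : ℝ) ≤
          effortSeq (fun _ => α.toStrategy n) (ω k).2.1 x₀ ω k :=
        hk.1.trans (hm.le.trans (hge k))
      rw [hs, stockSeq_succ, if_pos hacc, add_sub_cancel_left]
      exact hk.2
    obtain ⟨k, hk⟩ := ((hlim.comp hgap).eventually_lt_const hb).exists
    exact absurd hk (not_lt.2 (hge k))
  exact hseq.comp (tendsto_count hω harr)

end Game

end CollectiveInnovation

theorem mainTheorem5 {n : ℕ} (G : CollectiveInnovation.Game n) (hG : G.StandingAssumptions) :
    -- payoffs are well defined, for every profile of strategies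
    (∀ (σ : Fin n → CollectiveInnovation.Strategy n) (i : Fin n) (x₀ : ℝ), 0 ≤ x₀ →
      Integrable (fun p : CollectiveInnovation.Sample n × ℝ => G.discountedFlow σ i x₀ p.1 p.2)
        (G.P.prod (volume.restrict (Ioi (0 : ℝ))))) ∧
    (∃ α : CollectiveInnovation.MarkovStrategy,
      -- played by all agents, it maximises welfare among all profiles, for all initial stocks
      (∀ x₀ : ℝ, 0 ≤ x₀ →
        IsGreatest (range fun σ : Fin n → CollectiveInnovation.Strategy n => G.welfare σ x₀)
          (G.welfare (fun _ => α.toStrategy n) x₀)) ∧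
      -- it is the pointwise smallest efficient effort
      (∀ x : ℝ, 0 ≤ x → IsLeast (G.efficientEfforts x) (α.effort x)) ∧
      -- effort is decreasing in the stock, and vanishes almost surely over time
      AntitoneOn α.effort (Ici 0) ∧
      (∀ x₀ : ℝ, 0 ≤ x₀ → ∀ᵐ ω ∂G.P,
        Tendsto (fun t : ℝ => α.effort
            (CollectiveInnovation.stockAt (fun _ => α.toStrategy n) x₀ ω t)) atTop (𝓝 0))) ∧
    MonotoneOn G.maxWelfare (Ici 0) ∧
    AntitoneOn (fun x => G.maxWelfare x - G.b x) (Ici 0) ∧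
    Tendsto (fun x => G.maxWelfare x - G.b x) atTop (𝓝 0) := by
  obtain ⟨v, hv⟩ := hG.exists_isSolution
  have hanti := hG.optimalEffort_antitone hv
  let α : CollectiveInnovation.MarkovStrategy :=
    { effort := G.optimalEffort v
      measurable := hanti.measurable
      mem_Icc := hG.optimalEffort_mem v }
  have hgreat : ∀ x₀ : ℝ, 0 ≤ x₀ →
      IsGreatest (range fun σ : Fin n → CollectiveInnovation.Strategy n => G.welfare σ x₀)
        (G.welfare (fun _ => α.toStrategy n) x₀) := by
    refine fun x₀ hx₀ => ⟨⟨_, rfl⟩, ?_⟩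
    rintro _ ⟨σ, rfl⟩
    simp only
    rw [hG.welfare_optimal hv α rfl hx₀]
    exact hG.welfare_le hv σ hx₀
  have hmax : ∀ x, 0 ≤ x → G.maxWelfare x = v x := fun x hx => by
    rw [CollectiveInnovation.Game.maxWelfare, (hgreat x hx).csSup_eq, hG.welfare_optimal hv α rfl hx]
  refine ⟨fun σ i x₀ hx₀ => (hG.payoff_eq σ i hx₀ (hG.tsum_stageValue_ne_top hv σ i hx₀)).1,
    ⟨α, hgreat, fun x hx => ?_, hG.optimalEffort_antitoneOn hv, fun x₀ _ =>
      G.ae_tendsto_effort α hanti (hG.tendsto_optimalEffort hv) x₀⟩, ?_, ?_, ?_⟩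
  · have hint : ∫ z, G.maxWelfare (x + z) ∂G.F = ∫ z, v (x + z) ∂G.F := by
      refine integral_congr_ae ?_
      filter_upwards [G.ae_pos] with z hz using hmax _ (by linarith)
    have e : G.efficientEfforts x = G.maximisers v x := by
      have hobj : (fun a => a * G.lam * n * ((∫ z, G.maxWelfare (x + z) ∂G.F) -
          G.maxWelfare x) - G.c a x) = fun a => a * G.price v x - G.c a x := by
        funext a
        rw [hint, hmax x hx, CollectiveInnovation.Game.price, CollectiveInnovation.Game.rate]
        ring
      rw [CollectiveInnovation.Game.efficientEfforts, hobj, CollectiveInnovation.Game.maximisers]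
    rw [e]
    exact hG.isLeast_optimalEffort v hx
  · intro x hx y hy hxy
    rw [hmax x hx, hmax y hy]
    exact hv.mono hxy
  · intro x hx y hy hxy
    simp only [hmax x hx, hmax y hy]
    exact hv.anti hx hy hxy
  · refine (hG.tendsto_value_sub_b hv).congr' ?_
    filter_upwards [eventually_ge_atTop 0] with x hx
    rw [hmax x hx]
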